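/- **Setting.** Rooted trees are finite, nonempty, non-planar, and decorated by a set $\Omega$; a forest $F=T_1\cdots T_k$ is a finite multiset of trees, $\emptyset$ is the empty forest, $\mathcal F_\Omega$ is the real vector space spanned by forests (with concatenation as product), and $B_+^a(F)$ is the tree obtained from $F$ by adding a root decorated by $a$. Let $\lambda\in\mathbb R$ and let $(\Omega,\cdot)$ be a commutative semigroup (only a set if $\lambda=0$). The $\lambda$-shuffle product $\shuffle_\lambda$ on $\mathcal F_\Omega$ is the bilinear map with $\emptyset\shuffle_\lambda F=F\shuffle_\lambda\emptyset=F$, $$B_+^a(f)\shuffle_\lambda B_+^{b}(g)=B_+^a\big(f\shuffle_\lambda B_+^{b}(g)\big)+B_+^{b}\big(B_+^a(f)\shuffle_\lambda g\big)+\lambda B_+^{a\cdot b}(f\shuffle_\lambda g),$$ $$(T_1\cdots T_k)\shuffle_\lambda(t_1\cdots t_n)=\frac1{kn}\sum_{i=1}^k\sum_{j=1}^n (T_i\shuffle_\lambda t_j)\,\prod_{p\ne i}T_p\,\prod_{q\neq j}t_q\qquad(k,n\ge1).$$ We use $\Omega=(\mathbb N^*,+)$ for $\lambda=\pm1$ and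 $\Omega=\{x,y\}$ for $\lambda=0$, and write $\shuffle=\shuffle_0$. The associator is $[F_1,F_2,F_3]_{\shuffle_\lambda}=(F_1\shuffle_\lambda F_2)\shuffle_\lambda F_3-F_1\shuffle_\lambda(F_2\shuffle_\lambda F_3)$. *Stuffle arborified zeta maps.* $\mathcal F^{\rm conv}_{\mathbb N^*}$ is the span of the forests all of whose roots are decorated by integers $\ge 2$. Let $Z,Z^\star:\mathcal F_{\mathbb N^*}\to\mathbb R^{\mathbb N^*}$ be the algebra morphisms (for concatenation and the pointwise product) with $$Z(B_+^\alpha(F))(N)=\sum_{1\le n<N}n^{-\alpha}Z(F)(n),\qquad Z^\star(B_+^\alpha(F))(N)=\sum_{1\le n\le N}n^{-\alpha}Z^\star(F)(n)$$ for every forest $F$, and put $\zeta^T(F)=\lim_{N\to\infty}Z(F)(N)$, $\zeta^{T,\star}(F)=\lim_{N\to\infty}Z^\star(F)(N)$ for $F\in\mathcal F^{\rm conv}_{\mathbb N^*}$. *Shuffle arborified zeta map.* $\mathcal F^{\rm semi}_{\{x,y\}}$ is the span of the forests in which every leaf and every vertex with at least two children is decorated by $y$; $\mathcal F^{\rm conv}_{\{x,y\}}$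 is the span of those among them whose roots are all decorated by $x$. Put $\sigma_x(t)=1/t$, $\sigma_y(t)=1/(1-t)$. For $0<\epsilon<1$ let $I_\epsilon$ be the algebra morphism from $\mathcal F_{\{x,y\}}$ to functions on $[\epsilon,1)$ with $I_\epsilon(B_+^a(F))(z)=\int_\epsilon^z\sigma_a(t)\,I_\epsilon(F)(t)\,dt$ for every forest $F$. Put $Li^T_F(z)=\lim_{\epsilon\to0^+}I_\epsilon(F)(z)$ for $F\in\mathcal F^{\rm semi}_{\{x,y\}}$ and $z\in(0,1)$, and $\zeta^T_\shuffle(F)=\lim_{z\to1^-}Li^T_F(z)$ for $F\in\mathcal F^{\rm conv}_{\{x,y\}}$. **Statement.** All the limits above exist, so that $\zeta^T,\zeta^{T,\star}:\mathcal F^{\rm conv}_{\mathbb N^*}\to\mathbb R$ and $\zeta^T_\shuffle:\mathcal F^{\rm conv}_{\{x,y\}}\to\mathbb R$ are well-defined linear maps. For all $F_1,F_2,F_3\in\mathcal F^{\rm conv}_{\mathbb N^*}$ and all $f_1,f_2,f_3\in\mathcal F^{\rm conv}_{\{x,y\}}$, the associators lie in the respective spaces of convergent forests, and $$(F_1\shuffle_1F_2)\shuffle_1F_3-F_1\shuffle_1(F_2\shuffle_1F_3)\in\ker\zeta^T,$$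 $$(F_1\shuffle_{-1}F_2)\shuffle_{-1}F_3-F_1\shuffle_{-1}(F_2\shuffle_{-1}F_3)\in\ker\zeta^{T,\star},$$ $$(f_1\shuffle f_2)\shuffle f_3-f_1\shuffle(f_2\shuffle f_3)\in\ker\zeta^T_\shuffle .$$ -/

import Mathlib

namespace AZV

open Filter Topology

/-! ## Decorated rooted trees and forests -/

/-- Rooted trees with vertices decorated by `Ω`, with an order on the children of each vertex. -/
inductive PlanarTree (Ω : Type*) : Type _
  | node (a : Ω) (children : List (PlanarTree Ω)) : PlanarTree Ω

namespace PlanarTree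

variable {Ω : Type*}

/-- One elementary reordering: permute the children of one vertex of the tree. -/
inductive Reorder : PlanarTree Ω → PlanarTree Ω → Prop
  | perm (a : Ω) {l l' : List (PlanarTree Ω)} : l.Perm l' → Reorder (node a l) (node a l')
  | congr (a : Ω) {s t : PlanarTree Ω} (l : List (PlanarTree Ω)) :
      Reorder s t → Reorder (node a (s :: l)) (node a (t :: l))

/-- Evaluation from the leaves to the root: each vertex combines its decoration and the multiset
of the values of its children by means of `g`. -/
def fold {A : Type*} (g : Ω → Multiset A → A) : PlanarTree Ω → A
  | node a l => g a (l.map (fun t => fold g t) : List A)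

theorem fold_eq_of_reorder {A : Type*} (g : Ω → Multiset A → A) {s t : PlanarTree Ω}
    (h : Reorder s t) : fold g s = fold g t := by
  induction h with
  | perm a h => rw [fold, fold, Multiset.coe_eq_coe.2 (h.map _)]
  | congr a l h ih => rw [fold, fold, List.map_cons, List.map_cons, ih]

end PlanarTree

/-- Rooted trees decorated by `Ω` (nonempty, without order on the children of a vertex). -/
def RTree (Ω : Type*) : Type _ := Quot (PlanarTree.Reorder (Ω := Ω))

/-- Rooted forests decorated by `Ω`: finite multisets of trees. The empty forest is `0`, and the
concatenation of forests is `+`. -/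
abbrev Forest (Ω : Type*) : Type _ := Multiset (RTree Ω)

namespace RTree

variable {Ω : Type*}

/-- The tree obtained from a planar tree by forgetting the order on the children. -/
def mk (t : PlanarTree Ω) : RTree Ω := Quot.mk _ t

/-- A planar tree that represents the given tree. -/
noncomputable def out (T : RTree Ω) : PlanarTree Ω := Quot.out T

@[simp] theorem mk_out (T : RTree Ω) : mk (out T) = T := Quot.out_eq T

theorem mk_eq_of_reorder {s t : PlanarTree Ω} (h : PlanarTree.Reorder s t) : mk s = mk t :=
  Quot.sound h

/-- The decoration of the root. -/
def root : RTree Ω → Ω :=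
  Quot.lift (fun t => match t with | PlanarTree.node a _ => a) (by
    rintro _ _ (_ | _) <;> rfl)

/-- The forest that remains when the root is removed. -/
def children : RTree Ω → Forest Ω :=
  Quot.lift (fun t => match t with
      | PlanarTree.node _ l => ((l.map mk : List (RTree Ω)) : Forest Ω)) (by
    rintro _ _ (⟨a, h⟩ | ⟨a, l, h⟩)
    · exact Multiset.coe_eq_coe.2 (h.map _)
    · simp only [List.map_cons, mk_eq_of_reorder h])

/-- Grafting: the tree obtained from a forest by adding a common root decorated by `a`. -/
noncomputable def node (a : Ω) (F : Forest Ω) : RTree Ω :=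
  mk (PlanarTree.node a (F.toList.map out))

/-- Evaluation of a tree from the leaves to the root. -/
def fold {A : Type*} (g : Ω → Multiset A → A) : RTree Ω → A :=
  Quot.lift (PlanarTree.fold g) (fun _ _ h => PlanarTree.fold_eq_of_reorder g h)

/-- The number of vertices. -/
def size : RTree Ω → ℕ := fold (fun _ s => 1 + s.sum)

@[simp] theorem root_node (a : Ω) (F : Forest Ω) : (node a F).root = a := rfl

@[simp] theorem children_node (a : Ω) (F : Forest Ω) : (node a F).children = F := by
  show (((F.toList.map out).map mk : List (RTree Ω)) : Forest Ω) = F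
  simp [List.map_map, Function.comp_def]

private theorem mk_congr_list (a : Ω) {l l' : List (PlanarTree Ω)}
    (h : List.Forall₂ (fun s t => mk s = mk t) l l') (r : List (PlanarTree Ω)) :
    mk (PlanarTree.node a (l ++ r)) = mk (PlanarTree.node a (l' ++ r)) := by
  induction h generalizing r with
  | nil => rfl
  | @cons s t l l' hst _ ih =>
    have h1 : ∀ u : PlanarTree Ω, ∀ k : List (PlanarTree Ω),
        mk (PlanarTree.node a (u :: k ++ r)) = mk (PlanarTree.node a (k ++ u :: r)) := fun u k =>
      mk_eq_of_reorder (PlanarTree.Reorder.perm a (List.perm_middle (a := u)).symm)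
    have h2 : mk (PlanarTree.node a (s :: l ++ r)) = mk (PlanarTree.node a (t :: l ++ r)) := by
      have := Quot.eqvGen_exact hst
      clear hst h1 ih
      induction this with
      | rel x y h => exact mk_eq_of_reorder (PlanarTree.Reorder.congr a _ h)
      | refl x => rfl
      | symm x y _ ih => exact ih.symm
      | trans x y z _ _ ih ih' => exact ih.trans ih'
    rw [h2, h1, h1, ih]

@[simp] theorem node_root_children (T : RTree Ω) : node T.root T.children = T := by
  induction T using Quot.ind with
  | mk t =>
    obtain ⟨a, l⟩ := t
    show mk (PlanarTree.node a ((Multiset.toList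
      ((l.map mk : List (RTree Ω)) : Forest Ω)).map out)) = mk (PlanarTree.node a l)
    have hp : ((Multiset.toList ((l.map mk : List (RTree Ω)) : Forest Ω)).map
        out).Perm ((l.map mk).map out) :=
      List.Perm.map _ (Multiset.coe_eq_coe.1 (Multiset.coe_toList _))
    rw [mk_eq_of_reorder (PlanarTree.Reorder.perm a hp)]
    have := mk_congr_list a (l := (l.map mk).map out) (l' := l)
      (by
        rw [List.map_map, List.forall₂_map_left_iff, List.forall₂_same]
        exact fun t _ => mk_out _) []
    simpa using this

theorem fold_eq {A : Type*} (g : Ω → Multiset A → A) (T : RTree Ω) :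
    fold g T = g T.root (T.children.map (fold g)) := by
  induction T using Quot.ind with
  | mk t =>
    obtain ⟨a, l⟩ := t
    show PlanarTree.fold g _ = g a (Multiset.map (fold g) ((l.map mk : List (RTree Ω))))
    rw [PlanarTree.fold, Multiset.map_coe, List.map_map]
    rfl

theorem size_eq (T : RTree Ω) : T.size = 1 + (T.children.map size).sum := fold_eq _ T

theorem size_lt_of_mem {s T : RTree Ω} (h : s ∈ T.children) : s.size < T.size := by
  have : s.size ≤ (T.children.map size).sum :=
    Multiset.single_le_sum (by simp) _ (Multiset.mem_map_of_mem _ h)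
  rw [size_eq T]
  omega

end RTree

/-- The real vector space spanned by the forests decorated by `Ω`. Its multiplication is the
bilinear extension of the concatenation of forests; it is the free commutative algebra generated
by the trees. -/
abbrev ForestAlg (Ω : Type*) : Type _ := AddMonoidAlgebra ℝ (Forest Ω)

/-- A forest, as an element of the algebra of forests. -/
noncomputable def ofForest {Ω : Type*} (F : Forest Ω) : ForestAlg Ω := AddMonoidAlgebra.single F 1

/-- The linear extension of a map that is defined on forests. -/
noncomputable def linExt {Ω M : Type*} [AddCommGroup M] [Module ℝ M] (f : Forest Ω → M) :
    ForestAlg Ω →ₗ[ℝ] M :=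
  (AddMonoidAlgebra.basis (Forest Ω) ℝ).constr ℝ f

theorem linExt_ofForest {Ω M : Type*} [AddCommGroup M] [Module ℝ M] (f : Forest Ω → M)
    (F : Forest Ω) : linExt f (ofForest F) = f F := by
  have : ofForest F = AddMonoidAlgebra.basis (Forest Ω) ℝ F := by
    simp [ofForest]
  rw [this, linExt, Module.Basis.constr_basis]

/-- The grafting operator `B₊ᵃ`, extended linearly. -/
noncomputable def graft {Ω : Type*} (a : Ω) : ForestAlg Ω →ₗ[ℝ] ForestAlg Ω :=
  linExt fun F => ofForest {RTree.node a F}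

/-! ## Shuffle products of forests -/

section Shuffle

variable {Ω : Type*}

open Classical in
/-- The product of two forests `F = T₁⋯Tₖ` and `G = t₁⋯tₙ`, when the products `p Tᵢ tⱼ` of their
trees are known: `F` if `G` is empty, `G` if `F` is empty, and otherwise
`(1 / (k n)) ∑ᵢ ∑ⱼ (p Tᵢ tⱼ) · (F without Tᵢ) · (G without tⱼ)`. -/
noncomputable def combine (F G : Forest Ω) (p : ∀ T ∈ F, ∀ t ∈ G, ForestAlg Ω) : ForestAlg Ω :=
  if F = 0 then ofForest G
  else if G = 0 then ofForest F
  else ((F.card : ℝ) * (G.card : ℝ))⁻¹ •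
    (F.attach.map fun T => (G.attach.map fun t =>
      p T.1 T.2 t.1 t.2 * ofForest (F.erase T.1) * ofForest (G.erase t.1)).sum).sum

/-- The `lam`-shuffle product of two trees, where `op` is the product on the set of decorations:
`B₊ᵃ(f) ⧢ B₊ᵇ(g) = B₊ᵃ(f ⧢ B₊ᵇ(g)) + B₊ᵇ(B₊ᵃ(f) ⧢ g) + lam B₊^{op a b}(f ⧢ g)`. -/
noncomputable def shuffleTree (lam : ℝ) (op : Ω → Ω → Ω) (T T' : RTree Ω) : ForestAlg Ω :=
  graft T.root (combine T.children {T'} fun s _ t _ => shuffleTree lam op s t)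
    + graft T'.root (combine {T} T'.children fun s _ t _ => shuffleTree lam op s t)
    + lam • graft (op T.root T'.root)
        (combine T.children T'.children fun s _ t _ => shuffleTree lam op s t)
termination_by T.size + T'.size
decreasing_by
  all_goals
    try simp only [Multiset.mem_singleton] at *
    try subst_vars
    first
      | exact Nat.add_lt_add_right (RTree.size_lt_of_mem (by assumption)) _
      | exact Nat.add_lt_add_left (RTree.size_lt_of_mem (by assumption)) _
      | exact Nat.add_lt_add (RTree.size_lt_of_mem (by assumption))
          (RTree.size_lt_of_mem (by assumption))

/-- The `lam`-shuffle product of two forests. -/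
noncomputable def shuffleForest (lam : ℝ) (op : Ω → Ω → Ω) (F G : Forest Ω) : ForestAlg Ω :=
  combine F G fun T _ t _ => shuffleTree lam op T t

/-- The `lam`-shuffle product on the algebra of forests: the bilinear extension of the product
of forests. -/
noncomputable def shuffleWith (lam : ℝ) (op : Ω → Ω → Ω) :
    ForestAlg Ω →ₗ[ℝ] ForestAlg Ω →ₗ[ℝ] ForestAlg Ω :=
  linExt fun F => linExt fun G => shuffleForest lam op F G

/-- The `lam`-shuffle product over a commutative semigroup of decorations, written additively. -/
noncomputable def lambdaShuffle [AddCommSemigroup Ω] (lam : ℝ) :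
    ForestAlg Ω →ₗ[ℝ] ForestAlg Ω →ₗ[ℝ] ForestAlg Ω :=
  shuffleWith lam (· + ·)

/-- The shuffle product over a set of decorations. Since the weight is `0`, the term that
contains the product of two decorations vanishes, so that any operation may be put there. -/
noncomputable def shuffle : ForestAlg Ω →ₗ[ℝ] ForestAlg Ω →ₗ[ℝ] ForestAlg Ω :=
  shuffleWith 0 fun a _ => a

/-- The associator of a bilinear product. -/
noncomputable def associator (m : ForestAlg Ω →ₗ[ℝ] ForestAlg Ω →ₗ[ℝ] ForestAlg Ω) (F G H : ForestAlg Ω) :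
    ForestAlg Ω :=
  m (m F G) H - m F (m G H)

theorem shuffleForest_zero_left (lam : ℝ) (op : Ω → Ω → Ω) (G : Forest Ω) :
    shuffleForest lam op 0 G = ofForest G := by
  simp [shuffleForest, combine]

theorem shuffleForest_zero_right (lam : ℝ) (op : Ω → Ω → Ω) (F : Forest Ω) :
    shuffleForest lam op F 0 = ofForest F := by
  by_cases h : F = 0 <;> simp [shuffleForest, combine, h]

open Classical in
theorem shuffleForest_singleton (lam : ℝ) (op : Ω → Ω → Ω) (T t : RTree Ω) :
    shuffleForest lam op {T} {t} = shuffleTree lam op T t := by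
  have h : ofForest (0 : Forest Ω) = 1 := rfl
  rw [shuffleForest, combine, Multiset.attach_map_val' ({T} : Forest Ω) (fun T' =>
    (({t} : Forest Ω).attach.map fun t' => shuffleTree lam op T' t'.1
      * ofForest (({T} : Forest Ω).erase T') * ofForest (({t} : Forest Ω).erase t'.1)).sum)]
  rw [Multiset.map_singleton, Multiset.sum_singleton, Multiset.attach_map_val' ({t} : Forest Ω)
    (fun t' => shuffleTree lam op T t'
      * ofForest (({T} : Forest Ω).erase T) * ofForest (({t} : Forest Ω).erase t'))]
  simp [h]

open Classical in
theorem shuffleForest_of_ne_zero (lam : ℝ) (op : Ω → Ω → Ω) {F G : Forest Ω}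
    (hF : F ≠ 0) (hG : G ≠ 0) :
    shuffleForest lam op F G = ((F.card : ℝ) * (G.card : ℝ))⁻¹ •
      (F.map fun T => (G.map fun t => shuffleForest lam op {T} {t}
        * ofForest (F.erase T) * ofForest (G.erase t)).sum).sum := by
  simp only [shuffleForest_singleton]
  rw [shuffleForest, combine, if_neg hF, if_neg hG, ← Multiset.attach_map_val' F]
  congr 3
  funext T
  rw [← Multiset.attach_map_val' G]

theorem shuffleTree_eq (lam : ℝ) (op : Ω → Ω → Ω) (T T' : RTree Ω) :
    shuffleTree lam op T T' = graft T.root (shuffleForest lam op T.children {T'})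
      + graft T'.root (shuffleForest lam op {T} T'.children)
      + lam • graft (op T.root T'.root) (shuffleForest lam op T.children T'.children) := by
  rw [shuffleTree]
  rfl

theorem shuffleForest_node_node (lam : ℝ) (op : Ω → Ω → Ω) (a b : Ω) (f g : Forest Ω) :
    shuffleForest lam op {RTree.node a f} {RTree.node b g} =
      graft a (shuffleForest lam op f {RTree.node b g})
      + graft b (shuffleForest lam op {RTree.node a f} g)
      + lam • graft (op a b) (shuffleForest lam op f g) := by
  simp only [shuffleForest_singleton, shuffleTree_eq, RTree.root_node, RTree.children_node]

end Shuffle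

/-! ## Morphisms out of the algebra of forests -/

section Branching

/-- The unique morphism of commutative algebras `Φ` from the forests decorated by `Ω` to `A` with
`Φ(B₊ᵃ(F)) = β a (Φ(F))` for all decorations `a` and all forests `F`. -/
noncomputable def operatedHom {Ω A : Type*} [CommRing A] [Algebra ℝ A] (β : Ω → A → A) :
    ForestAlg Ω →ₐ[ℝ] A :=
  AddMonoidAlgebra.lift ℝ A (Forest Ω)
    { toFun := fun F => (F.toAdd.map (RTree.fold fun a s => β a s.prod)).prod
      map_one' := by rw [toAdd_one, Multiset.map_zero, Multiset.prod_zero]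
      map_mul' := fun F G => by rw [toAdd_mul, Multiset.map_add, Multiset.prod_add] }

theorem operatedHom_ofForest {Ω A : Type*} [CommRing A] [Algebra ℝ A] (β : Ω → A → A)
    (F : Forest Ω) :
    operatedHom β (ofForest F) = (F.map (RTree.fold fun a s => β a s.prod)).prod := by
  rw [operatedHom, ofForest, AddMonoidAlgebra.lift_single, one_smul]
  rfl

theorem operatedHom_graft {Ω A : Type*} [CommRing A] [Algebra ℝ A] (β : Ω → A → A) (a : Ω)
    (F : Forest Ω) :
    operatedHom β (graft a (ofForest F)) = β a (operatedHom β (ofForest F)) := by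
  rw [graft, linExt_ofForest]
  rw [operatedHom_ofForest, operatedHom_ofForest, Multiset.map_singleton,
    Multiset.prod_singleton, RTree.fold_eq, RTree.root_node, RTree.children_node]

/-- The branched map of a map `φ` from an algebra to itself. -/
noncomputable def branched {A : Type*} [CommRing A] [Algebra ℝ A] (φ : A → A) :
    ForestAlg A →ₐ[ℝ] A :=
  operatedHom fun a u => φ (a * u)

/-- The lifting to forests of a map between the sets of decorations. -/
noncomputable def lifted {Ω₁ Ω₂ : Type*} (φ : Ω₁ → Ω₂) : ForestAlg Ω₁ →ₐ[ℝ] ForestAlg Ω₂ :=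
  operatedHom fun a F => graft (φ a) F

end Branching

/-! ## Stuffle arborified zeta values -/

section Stuffle

/-- The sequence `n ↦ n ^ (-α)`, for a positive integer `α`. -/
noncomputable def powerSeq (α : ℕ+) : ℕ+ → ℝ := fun n => ((n : ℝ) ^ (α : ℕ))⁻¹

/-- The summation operator `σ ↦ (N ↦ ∑_{1 ≤ n < N} σ n)`. -/
noncomputable def strictSum (σ : ℕ+ → ℝ) : ℕ+ → ℝ := fun N => ∑ n ∈ Finset.Ico 1 N, σ n

/-- The summation operator `σ ↦ (N ↦ ∑_{1 ≤ n ≤ N} σ n)`. -/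
noncomputable def largeSum (σ : ℕ+ → ℝ) : ℕ+ → ℝ := fun N => ∑ n ∈ Finset.Icc 1 N, σ n

/-- The truncated arborified zeta values with strict inequalities. -/
noncomputable def truncStrict : ForestAlg ℕ+ →ₐ[ℝ] (ℕ+ → ℝ) :=
  (branched strictSum).comp (lifted powerSeq)

/-- The truncated arborified zeta values with large inequalities. -/
noncomputable def truncLarge : ForestAlg ℕ+ →ₐ[ℝ] (ℕ+ → ℝ) :=
  (branched largeSum).comp (lifted powerSeq)

/-- A forest decorated by positive integers is convergent if the roots of all its trees have
decorations at least `2`. -/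
def ConvergentN (F : Forest ℕ+) : Prop := ∀ T ∈ F, 2 ≤ T.root

/-- The space of convergent forests decorated by positive integers. -/
noncomputable def convN : Submodule ℝ (ForestAlg ℕ+) :=
  Submodule.span ℝ (ofForest '' {F | ConvergentN F})

/-- The stuffle arborified zeta map `ζᵀ`: the linear map with `F ↦ lim_N truncStrict F N` on
convergent forests. -/
noncomputable def zetaStuffle : convN →ₗ[ℝ] ℝ :=
  (linExt fun F => limUnder atTop (truncStrict (ofForest F))).domRestrict convN

/-- The stuffle arborified zeta map `ζ^{T,⋆}`: the linear map with `F ↦ lim_N truncLarge F N` on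
convergent forests. -/
noncomputable def zetaStuffleStar : convN →ₗ[ℝ] ℝ :=
  (linExt fun F => limUnder atTop (truncLarge (ofForest F))).domRestrict convN

end Stuffle

/-! ## Shuffle arborified zeta values -/

section ShuffleZeta

/-- The alphabet `{x, y}`. -/
inductive Letter
  | x
  | y

/-- The functions `σ_x(t) = 1 / t` and `σ_y(t) = 1 / (1 - t)`, which are only used on `(0, 1)`. -/
noncomputable def letterFun : Letter → ℝ → ℝ
  | Letter.x => fun t => 1 / t
  | Letter.y => fun t => 1 / (1 - t)

/-- The integration map with base point `ε`. -/
noncomputable def integrateFrom (ε : ℝ) (f : ℝ → ℝ) : ℝ → ℝ := fun x => ∫ t in ε..x, f t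

/-- The arborified Chen integrals with base point `ε`, for the functions `σ_x` and `σ_y`; only
the values on `[ε, 1)` for `0 < ε < 1` are used. -/
noncomputable def chenIntegral (ε : ℝ) : ForestAlg Letter →ₐ[ℝ] (ℝ → ℝ) :=
  (branched (integrateFrom ε)).comp (lifted letterFun)

/-- All leaves and all branching vertices of the tree are decorated by `y`. -/
inductive SemiconvergentTree : RTree Letter → Prop
  | node (a : Letter) (F : Forest Letter) (hroot : F.card = 0 ∨ 2 ≤ F.card → a = Letter.y)
      (hF : ∀ T ∈ F, SemiconvergentTree T) : SemiconvergentTree (RTree.node a F)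

/-- A forest is semiconvergent if all its leaves and branching vertices are decorated by `y`. -/
def SemiconvergentXY (F : Forest Letter) : Prop := ∀ T ∈ F, SemiconvergentTree T

/-- A forest is convergent if it is semiconvergent and all its roots are decorated by `x`. -/
def ConvergentXY (F : Forest Letter) : Prop :=
  SemiconvergentXY F ∧ ∀ T ∈ F, T.root = Letter.x

/-- The space of semiconvergent forests decorated by `x` and `y`. -/
noncomputable def semiXY : Submodule ℝ (ForestAlg Letter) :=
  Submodule.span ℝ (ofForest '' {F | SemiconvergentXY F})

/-- The space of convergent forests decorated by `x` and `y`. -/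
noncomputable def convXY : Submodule ℝ (ForestAlg Letter) :=
  Submodule.span ℝ (ofForest '' {F | ConvergentXY F})

/-- The arborified polylogarithm map `F ↦ Li_F`, extended linearly; it is used for semiconvergent
forests and on `[0, 1)`. -/
noncomputable def polylog : ForestAlg Letter →ₗ[ℝ] (ℝ → ℝ) :=
  linExt fun F z =>
    if z = 0 then 0 else limUnder (𝓝[>] (0 : ℝ)) fun ε => chenIntegral ε (ofForest F) z

/-- The shuffle arborified zeta map `ζᵀ_⧢`: the linear map with `F ↦ lim_{z → 1⁻} Li_F(z)` on
convergent forests. -/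
noncomputable def zetaShuffle : convXY →ₗ[ℝ] ℝ :=
  (linExt fun F => limUnder (𝓝[<] (1 : ℝ)) (polylog (ofForest F))).domRestrict convXY

end ShuffleZeta

/-- The kernel of a linear map that is defined on a subspace of the forests, as a subspace of
the space of all forests. -/
noncomputable def kernel {Ω : Type*} {C : Submodule ℝ (ForestAlg Ω)} (z : C →ₗ[ℝ] ℝ) :
    Submodule ℝ (ForestAlg Ω) :=
  (LinearMap.ker z).map C.subtype

end AZV

namespace AZV

open Filter Topology

/-! ### Induction on trees and linear maps determined by forests. -/

section Basics

variable {Ω : Type*}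

/-! The forest shuffle is not assumed associative; what matters is that suitable morphisms cannot
see the defect. Let Φ be an algebra morphism for concatenation with Φ(B₊ᵃ(F)) = P(e_a Φ(F)), where P
is a Rota-Baxter operator of weight λ and e is multiplicative (no condition if λ = 0). Then Φ is
also multiplicative for the λ-shuffle (`operatedHom_shuffleForest`): on trees this is the
Rota-Baxter identity, and on forests all kn terms of the average have the same image. Since the
target is associative, Φ kills every associator (`map_associator_eq_zero`).

The zeta maps are limits of such morphisms: strict sums have weight 1, large sums weight -1
(`sumOver_Ico_mul`, `sumOver_Icc_mul`), and integration from ε has weight 0 (`primitive_mul`). Every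
truncated value of an associator is therefore zero, and so is its limit, once two points are
settled.

Stability: shuffles of convergent forests are convergent (`lambdaShuffle_mem_convN`,
`shuffle_mem_convXY`).

Existence of the limits: all values are nonnegative and monotone in the truncation, so bounds
suffice. A tree grows at most like a power of a logarithm, with one factor per vertex
(`truncZeta_tree_bounds`, `chenAt_tree_le`). A root ≥ 2, respectively x, turns this into a
convergent sum or integral, because a power of a logarithm is dominated by a square root. -/

theorem RTree.induction {p : RTree Ω → Prop}
    (h : ∀ a F, (∀ T ∈ F, p T) → p (RTree.node a F)) (T : RTree Ω) : p T := by
  induction hn : T.size using Nat.strong_induction_on generalizing T with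
  | _ n ih =>
    subst hn
    rw [← RTree.node_root_children T]
    exact h _ _ fun S hS => ih _ (RTree.size_lt_of_mem hS) S rfl

theorem ofForest_zero : ofForest (0 : Forest Ω) = 1 := rfl

theorem ofForest_add (F G : Forest Ω) : ofForest (F + G) = ofForest F * ofForest G := by
  simp [ofForest, AddMonoidAlgebra.single_mul_single]

theorem ofForest_cons (T : RTree Ω) (F : Forest Ω) :
    ofForest (T ::ₘ F) = ofForest {T} * ofForest F := by
  rw [← ofForest_add, Multiset.singleton_add]

theorem graft_ofForest (a : Ω) (F : Forest Ω) :
    graft a (ofForest F) = ofForest {RTree.node a F} :=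
  linExt_ofForest _ _

theorem linearMap_ext_ofForest {M : Type*} [AddCommGroup M] [Module ℝ M]
    {f g : ForestAlg Ω →ₗ[ℝ] M} (h : ∀ F, f (ofForest F) = g (ofForest F)) : f = g := by
  refine (AddMonoidAlgebra.basis (Forest Ω) ℝ).ext fun F => ?_
  have : ofForest F = AddMonoidAlgebra.basis (Forest Ω) ℝ F := by
    simp [ofForest]
  rw [← this, h]

theorem algHom_ext_ofForest {A : Type*} [CommRing A] [Algebra ℝ A]
    {f g : ForestAlg Ω →ₐ[ℝ] A} (h : ∀ F, f (ofForest F) = g (ofForest F)) : f = g :=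
  AlgHom.toLinearMap_injective (linearMap_ext_ofForest h)

theorem prod_map_ofForest_singleton {Ω' : Type*} (g : RTree Ω' → RTree Ω) (F : Forest Ω') :
    (F.map fun T => ofForest {g T}).prod = ofForest (F.map g) := by
  induction F using Multiset.induction_on with
  | empty => rfl
  | cons T F ih => rw [Multiset.map_cons, Multiset.prod_cons, ih, Multiset.map_cons,
      ofForest_cons]

end Basics

/-! ### Recursive description of the operated morphisms. -/

section OperatedHom

variable {Ω A : Type*} [CommRing A] [Algebra ℝ A]

theorem operatedHom_node (β : Ω → A → A) (a : Ω) (F : Forest Ω) :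
    operatedHom β (ofForest {RTree.node a F}) = β a (operatedHom β (ofForest F)) := by
  rw [← graft_ofForest, operatedHom_graft]

/-- Shuffles are linear combinations of forests, so the recursion is needed on arbitrary elements;
linearity of `P a` provides the extension. -/
theorem operatedHom_graft_of_linear (P : Ω → A →ₗ[ℝ] A) (a : Ω) (u : ForestAlg Ω) :
    operatedHom (fun a => P a) (graft a u) = P a (operatedHom (fun a => P a) u) := by
  have : (operatedHom fun a => P a).toLinearMap ∘ₗ graft a =
      P a ∘ₗ (operatedHom fun a => P a).toLinearMap :=
    linearMap_ext_ofForest fun F => operatedHom_graft _ a F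
  exact LinearMap.congr_fun this u

theorem fold_lifted {Ω' : Type*} (φ : Ω → Ω') (T : RTree Ω) :
    RTree.fold (fun a s => graft (φ a) s.prod) T =
      ofForest {RTree.fold (fun a s => RTree.node (φ a) s) T} := by
  induction T using RTree.induction with
  | h a F ih =>
    rw [RTree.fold_eq, RTree.fold_eq (fun a s => RTree.node (φ a) s), RTree.root_node,
      RTree.children_node, Multiset.map_congr rfl ih, prod_map_ofForest_singleton, graft_ofForest]

theorem lifted_ofForest {Ω' : Type*} (φ : Ω → Ω') (F : Forest Ω) :
    lifted φ (ofForest F) = ofForest (F.map (RTree.fold fun a s => RTree.node (φ a) s)) := by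
  rw [lifted, operatedHom_ofForest, Multiset.map_congr rfl fun T _ => fold_lifted φ T,
    prod_map_ofForest_singleton]

/-- Merges the two-stage definition of the truncated values into one recursion, the form to which
the Rota-Baxter argument applies. -/
theorem branched_comp_lifted (ψ : A → A) (φ : Ω → A) :
    (branched ψ).comp (lifted φ) = operatedHom fun a u => ψ (φ a * u) := by
  have key : ∀ T : RTree Ω, RTree.fold (fun a s => ψ (a * s.prod))
      (RTree.fold (fun a s => RTree.node (φ a) s) T) =
        RTree.fold (fun a s => ψ (φ a * s.prod)) T := by
    intro T
    induction T using RTree.induction with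
    | h a F ih =>
      rw [RTree.fold_eq (fun a s => RTree.node (φ a) s), RTree.fold_eq, RTree.root_node,
        RTree.children_node, RTree.root_node, RTree.children_node, Multiset.map_map,
        RTree.fold_eq, RTree.root_node, RTree.children_node]
      rw [Multiset.map_congr rfl ih |>.symm]
      rfl
  refine algHom_ext_ofForest fun F => ?_
  rw [AlgHom.comp_apply, lifted_ofForest, branched, operatedHom_ofForest, operatedHom_ofForest,
    Multiset.map_map]
  exact congrArg _ (Multiset.map_congr rfl fun T _ => key T)

end OperatedHom

/-! ### Rota-Baxter operators yield morphisms for the shuffle products. -/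

section RotaBaxter

variable {Ω A : Type*} [CommRing A] [Algebra ℝ A]

open Classical in
-- Multiplying the image of `T ⧢ t` by the images of the remaining trees restores `Φ F * Φ G`
-- whichever pair was chosen, so the average has this value. The hypothesis concerns only trees of
-- `F` and `G`, which makes the lemma usable inside an induction on size.
theorem map_shuffleForest_of_trees (lam : ℝ) (op : Ω → Ω → Ω) (Φ : ForestAlg Ω →ₐ[ℝ] A)
    (F G : Forest Ω)
    (h : ∀ T ∈ F, ∀ t ∈ G, Φ (shuffleTree lam op T t) = Φ (ofForest {T}) * Φ (ofForest {t})) :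
    Φ (shuffleForest lam op F G) = Φ (ofForest F) * Φ (ofForest G) := by
  by_cases hF : F = 0
  · rw [hF, shuffleForest_zero_left, ofForest_zero, map_one, one_mul]
  by_cases hG : G = 0
  · rw [hG, shuffleForest_zero_right, ofForest_zero, map_one, mul_one]
  have hF' : (F.card : ℝ) ≠ 0 := by simpa using hF
  have hG' : (G.card : ℝ) ≠ 0 := by simpa using hG
  have key : ∀ T ∈ F, ∀ t ∈ G, Φ (shuffleForest lam op {T} {t} * ofForest (F.erase T) *
      ofForest (G.erase t)) = Φ (ofForest F) * Φ (ofForest G) := by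
    intro T hT t ht
    have e1 := congrArg Φ (ofForest_cons T (F.erase T))
    have e2 := congrArg Φ (ofForest_cons t (G.erase t))
    rw [Multiset.cons_erase hT, map_mul] at e1
    rw [Multiset.cons_erase ht, map_mul] at e2
    rw [shuffleForest_singleton, map_mul, map_mul, h T hT t ht, e1, e2]
    ring
  rw [shuffleForest_of_ne_zero lam op hF hG, map_smul, map_multiset_sum, Multiset.map_map]
  have : F.map (Φ ∘ fun T => (G.map fun t => shuffleForest lam op {T} {t} *
      ofForest (F.erase T) * ofForest (G.erase t)).sum) =
      F.map fun _ => G.card • (Φ (ofForest F) * Φ (ofForest G)) := by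
    refine Multiset.map_congr rfl fun T hT => ?_
    rw [Function.comp_apply, map_multiset_sum, Multiset.map_map, Function.comp_def,
      Multiset.map_congr rfl (fun t ht => key T hT t ht), Multiset.map_const',
      Multiset.sum_replicate]
  rw [this, Multiset.map_const', Multiset.sum_replicate, ← Nat.cast_smul_eq_nsmul ℝ,
    ← Nat.cast_smul_eq_nsmul ℝ, smul_smul, smul_smul, mul_assoc, inv_mul_cancel₀ (mul_ne_zero hF' hG'),
    one_smul]

/-- A morphism that turns grafting into a Rota-Baxter operator is multiplicative for the shuffle
product of the same weight. -/
theorem operatedHom_shuffleForest (lam : ℝ) (op : Ω → Ω → Ω) (P : A →ₗ[ℝ] A) (e : Ω → A)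
    (hP : ∀ u v, P u * P v = P (u * P v) + P (P u * v) + lam • P (u * v))
    (he : ∀ a b, lam • e (op a b) = lam • (e a * e b)) (F G : Forest Ω) :
    operatedHom (fun a u => P (e a * u)) (shuffleForest lam op F G) =
      operatedHom (fun a u => P (e a * u)) (ofForest F) *
        operatedHom (fun a u => P (e a * u)) (ofForest G) := by
  set Φ : ForestAlg Ω →ₐ[ℝ] A := operatedHom (fun a u => P (e a * u)) with hΦ
  have hgraft : ∀ a u, Φ (graft a u) = P (e a * Φ u) := fun a u =>
    operatedHom_graft_of_linear (fun a => P ∘ₗ LinearMap.mulLeft ℝ (e a)) a u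
  -- Induction on the total number of vertices: each of the three terms of the recursion removes at
  -- least one root.
  have key : ∀ n, ∀ T T' : RTree Ω, T.size + T'.size = n →
      Φ (shuffleTree lam op T T') = Φ (ofForest {T}) * Φ (ofForest {T'}) := by
    intro n
    induction n using Nat.strong_induction_on with
    | _ n ih =>
      intro T T' hn
      have h1 : Φ (shuffleForest lam op T.children {T'}) =
          Φ (ofForest T.children) * Φ (ofForest {T'}) := by
        refine map_shuffleForest_of_trees _ _ _ _ _ fun s hs t ht => ih _ ?_ s t rfl
        rw [Multiset.mem_singleton] at ht
        subst ht
        have := RTree.size_lt_of_mem hs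
        omega
      have h2 : Φ (shuffleForest lam op {T} T'.children) =
          Φ (ofForest {T}) * Φ (ofForest T'.children) := by
        refine map_shuffleForest_of_trees _ _ _ _ _ fun s hs t ht => ih _ ?_ s t rfl
        rw [Multiset.mem_singleton] at hs
        subst hs
        have := RTree.size_lt_of_mem ht
        omega
      have h3 : Φ (shuffleForest lam op T.children T'.children) =
          Φ (ofForest T.children) * Φ (ofForest T'.children) := by
        refine map_shuffleForest_of_trees _ _ _ _ _ fun s hs t ht => ih _ ?_ s t rfl
        have := RTree.size_lt_of_mem hs
        have := RTree.size_lt_of_mem ht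
        omega
      have hT : ∀ S : RTree Ω, Φ (ofForest {S}) = P (e S.root * Φ (ofForest S.children)) := by
        intro S
        rw [← hgraft, graft_ofForest, RTree.node_root_children]
      -- Compatibility of `e` with `op` holds only after scaling by `lam`, so the scalar is moved
      -- inside `P` before `he` is applied.
      have hlam : lam • P (e (op T.root T'.root) * (Φ (ofForest T.children) *
          Φ (ofForest T'.children))) = lam • P (e T.root * e T'.root * (Φ (ofForest T.children) *
          Φ (ofForest T'.children))) := by
        rw [← map_smul, ← smul_mul_assoc, he, smul_mul_assoc, map_smul]
      rw [shuffleTree_eq, map_add, map_add, map_smul, hgraft, hgraft, hgraft, h1, h2, h3, hlam,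
        hT T, hT T', hP]
      congr 2 <;> congr 1 <;> ring
  exact map_shuffleForest_of_trees _ _ _ _ _ fun T _ t _ => key _ T t rfl

theorem map_shuffleWith {lam : ℝ} {op : Ω → Ω → Ω} {Φ : ForestAlg Ω →ₐ[ℝ] A}
    (h : ∀ F G, Φ (shuffleForest lam op F G) = Φ (ofForest F) * Φ (ofForest G))
    (u v : ForestAlg Ω) : Φ (shuffleWith lam op u v) = Φ u * Φ v := by
  have : (shuffleWith lam op).compr₂ Φ.toLinearMap =
      (LinearMap.mul ℝ A).compl₁₂ Φ.toLinearMap Φ.toLinearMap := by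
    refine linearMap_ext_ofForest fun F => linearMap_ext_ofForest fun G => ?_
    simp only [LinearMap.compr₂_apply, LinearMap.compl₁₂_apply, shuffleWith, linExt_ofForest]
    exact h F G
  exact LinearMap.congr_fun (LinearMap.congr_fun this u) v

theorem map_associator_eq_zero {m : ForestAlg Ω →ₗ[ℝ] ForestAlg Ω →ₗ[ℝ] ForestAlg Ω}
    {Φ : ForestAlg Ω →ₐ[ℝ] A} (h : ∀ u v, Φ (m u v) = Φ u * Φ v) (u v w : ForestAlg Ω) :
    Φ (associator m u v w) = 0 := by
  rw [associator, map_sub, h, h, h, h, mul_assoc, sub_self]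

end RotaBaxter

/-! ### Stability of subspaces of forests under the shuffle products -/

section Span

variable {Ω : Type*}

/-- The span of the forests whose trees all satisfy `p`. -/
noncomputable def forestSpan (p : RTree Ω → Prop) : Submodule ℝ (ForestAlg Ω) :=
  Submodule.span ℝ (ofForest '' {F | ∀ T ∈ F, p T})

/-- The span of the trees that satisfy `p`. -/
noncomputable def treeSpan (p : RTree Ω → Prop) : Submodule ℝ (ForestAlg Ω) :=
  Submodule.span ℝ ((fun T => ofForest {T}) '' {T | p T})

theorem ofForest_mem_forestSpan {p : RTree Ω → Prop} {F : Forest Ω} (h : ∀ T ∈ F, p T) :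
    ofForest F ∈ forestSpan p :=
  Submodule.subset_span ⟨F, h, rfl⟩

theorem ofForest_mem_treeSpan {p : RTree Ω → Prop} {T : RTree Ω} (h : p T) :
    ofForest {T} ∈ treeSpan p :=
  Submodule.subset_span ⟨T, h, rfl⟩

theorem treeSpan_le_forestSpan (p : RTree Ω → Prop) : treeSpan p ≤ forestSpan p := by
  rw [treeSpan, Submodule.span_le]
  rintro _ ⟨T, hT, rfl⟩
  exact ofForest_mem_forestSpan (by simpa using hT)

theorem treeSpan_mono {p q : RTree Ω → Prop} (h : ∀ T, p T → q T) : treeSpan p ≤ treeSpan q :=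
  Submodule.span_mono (Set.image_mono h)

theorem mul_mem_forestSpan {p : RTree Ω → Prop} {u v : ForestAlg Ω} (hu : u ∈ forestSpan p)
    (hv : v ∈ forestSpan p) : u * v ∈ forestSpan p := by
  refine LinearMap.BilinMap.apply_apply_mem_of_mem_span (forestSpan p) _ _
    (LinearMap.mul ℝ (ForestAlg Ω)) ?_ u v hu hv
  rintro _ ⟨F, hF, rfl⟩ _ ⟨G, hG, rfl⟩
  rw [LinearMap.mul_apply', ← ofForest_add]
  refine ofForest_mem_forestSpan fun T hT => ?_
  rcases Multiset.mem_add.1 hT with h | h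
  exacts [hF T h, hG T h]

theorem graft_mem_treeSpan {p q : RTree Ω → Prop} {a : Ω} {u : ForestAlg Ω}
    (h : ∀ F, (∀ T ∈ F, p T) → q (RTree.node a F)) (hu : u ∈ forestSpan p) :
    graft a u ∈ treeSpan q := by
  have : forestSpan p ≤ (treeSpan q).comap (graft a) := by
    rw [forestSpan, Submodule.span_le]
    rintro _ ⟨F, hF, rfl⟩
    rw [SetLike.mem_coe, Submodule.mem_comap, graft_ofForest]
    exact ofForest_mem_treeSpan (h F hF)
  exact this hu

/-- Grafting a root x keeps semiconvergence only over a single child, so combinations of trees must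
be tracked separately from combinations of forests. -/
theorem graft_mem_treeSpan_of_tree {p q : RTree Ω → Prop} {a : Ω} {u : ForestAlg Ω}
    (h : ∀ T, p T → q (RTree.node a {T})) (hu : u ∈ treeSpan p) :
    graft a u ∈ treeSpan q := by
  have : treeSpan p ≤ (treeSpan q).comap (graft a) := by
    rw [treeSpan, Submodule.span_le]
    rintro _ ⟨T, hT, rfl⟩
    rw [SetLike.mem_coe, Submodule.mem_comap, graft_ofForest]
    exact ofForest_mem_treeSpan (h T hT)
  exact this hu

open Classical in
theorem shuffleForest_mem_forestSpan {lam : ℝ} {op : Ω → Ω → Ω} {p : RTree Ω → Prop}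
    {F G : Forest Ω} (hF : ∀ T ∈ F, p T) (hG : ∀ T ∈ G, p T)
    (h : ∀ T ∈ F, ∀ t ∈ G, shuffleTree lam op T t ∈ treeSpan p) :
    shuffleForest lam op F G ∈ forestSpan p := by
  by_cases hF0 : F = 0
  · rw [hF0, shuffleForest_zero_left]
    exact ofForest_mem_forestSpan hG
  by_cases hG0 : G = 0
  · rw [hG0, shuffleForest_zero_right]
    exact ofForest_mem_forestSpan hF
  rw [shuffleForest_of_ne_zero lam op hF0 hG0]
  refine Submodule.smul_mem _ _ (multiset_sum_mem _ fun u hu => ?_)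
  obtain ⟨T, hT, rfl⟩ := Multiset.mem_map.1 hu
  refine multiset_sum_mem _ fun u hu => ?_
  obtain ⟨t, ht, rfl⟩ := Multiset.mem_map.1 hu
  rw [shuffleForest_singleton]
  exact mul_mem_forestSpan (mul_mem_forestSpan (treeSpan_le_forestSpan p (h T hT t ht))
    (ofForest_mem_forestSpan fun S hS => hF S (Multiset.mem_of_mem_erase hS)))
    (ofForest_mem_forestSpan fun S hS => hG S (Multiset.mem_of_mem_erase hS))

theorem shuffleWith_mem_forestSpan {lam : ℝ} {op : Ω → Ω → Ω} {p : RTree Ω → Prop}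
    (h : ∀ T, p T → ∀ t, p t → shuffleTree lam op T t ∈ treeSpan p) {u v : ForestAlg Ω}
    (hu : u ∈ forestSpan p) (hv : v ∈ forestSpan p) :
    shuffleWith lam op u v ∈ forestSpan p := by
  refine LinearMap.BilinMap.apply_apply_mem_of_mem_span (forestSpan p) _ _
    (shuffleWith lam op) ?_ u v hu hv
  rintro _ ⟨F, hF, rfl⟩ _ ⟨G, hG, rfl⟩
  rw [shuffleWith, linExt_ofForest, linExt_ofForest]
  exact shuffleForest_mem_forestSpan hF hG fun T hT t ht => h T (hF T hT) t (hG t ht)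

theorem associator_mem {m : ForestAlg Ω →ₗ[ℝ] ForestAlg Ω →ₗ[ℝ] ForestAlg Ω}
    {C : Submodule ℝ (ForestAlg Ω)} (h : ∀ u ∈ C, ∀ v ∈ C, m u v ∈ C) {u v w : ForestAlg Ω}
    (hu : u ∈ C) (hv : v ∈ C) (hw : w ∈ C) : associator m u v w ∈ C :=
  sub_mem (h _ (h _ hu _ hv) _ hw) (h _ hu _ (h _ hv _ hw))

/-- For integer decorations convergence depends on the root alone, so nothing has to be known about
the grafted element. -/
theorem graft_mem_treeSpan_root {q : RTree Ω → Prop} {a : Ω}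
    (h : ∀ T : RTree Ω, T.root = a → q T) (u : ForestAlg Ω) : graft a u ∈ treeSpan q := by
  have hu : u ∈ forestSpan fun _ : RTree Ω => True := by
    have : (forestSpan fun _ : RTree Ω => True) = ⊤ := by
      rw [forestSpan, eq_top_iff, ← (AddMonoidAlgebra.basis (Forest Ω) ℝ).span_eq]
      refine Submodule.span_mono ?_
      rintro _ ⟨F, rfl⟩
      exact ⟨F, fun _ _ => trivial, by simp [ofForest]⟩
    rw [this]
    trivial
  exact graft_mem_treeSpan (fun F _ => h _ (RTree.root_node a F)) hu

theorem lambdaShuffle_mem_convN (lam : ℝ) {u v : ForestAlg ℕ+} (hu : u ∈ convN)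
    (hv : v ∈ convN) : lambdaShuffle lam u v ∈ convN := by
  refine shuffleWith_mem_forestSpan (p := fun T : RTree ℕ+ => 2 ≤ T.root)
    (fun T hT t ht => ?_) hu hv
  rw [shuffleTree_eq]
  refine add_mem (add_mem ?_ ?_) (Submodule.smul_mem _ _ ?_)
  · exact graft_mem_treeSpan_root (fun S hS => hS ▸ hT) _
  · exact graft_mem_treeSpan_root (fun S hS => hS ▸ ht) _
  · exact graft_mem_treeSpan_root (fun S hS => hS ▸ hT.trans (PNat.lt_add_right _ _).le) _

theorem semiconvergentTree_iff (T : RTree Letter) : SemiconvergentTree T ↔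
    (T.children.card = 0 ∨ 2 ≤ T.children.card → T.root = Letter.y) ∧
      ∀ S ∈ T.children, SemiconvergentTree S := by
  constructor
  · rintro ⟨a, F, h1, h2⟩
    rw [RTree.root_node, RTree.children_node]
    exact ⟨h1, h2⟩
  · rintro ⟨h1, h2⟩
    rw [← RTree.node_root_children T]
    exact .node _ _ h1 h2

theorem SemiconvergentTree.exists_child {T : RTree Letter} (hT : SemiconvergentTree T)
    (hx : T.root = Letter.x) : ∃ S, T.children = {S} ∧ SemiconvergentTree S := by
  obtain ⟨h1, h2⟩ := (semiconvergentTree_iff T).1 hT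
  have hne : ¬ (T.children.card = 0 ∨ 2 ≤ T.children.card) := fun h => by
    have := h1 h
    rw [hx] at this
    cases this
  obtain ⟨S, hS⟩ := Multiset.card_eq_one.1 (show T.children.card = 1 by omega)
  exact ⟨S, hS, h2 S (by simp [hS])⟩

/-- Weight 0 creates no merged root. Under a root y any semiconvergent forest is allowed. A root x
has exactly one child, whose shuffle with the other tree is again a combination of single trees, so
x acquires neither branching nor the position of a leaf. -/
theorem shuffleTree_zero_mem_treeSpan {op : Letter → Letter → Letter} {T T' : RTree Letter}
    (hT : SemiconvergentTree T) (hT' : SemiconvergentTree T') :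
    shuffleTree 0 op T T' ∈ treeSpan fun S =>
      SemiconvergentTree S ∧ (S.root = T.root ∨ S.root = T'.root) := by
  induction hn : T.size + T'.size using Nat.strong_induction_on generalizing T T' with
  | _ n ih =>
    subst hn
    have hcT := ((semiconvergentTree_iff T).1 hT).2
    have hcT' := ((semiconvergentTree_iff T').1 hT').2
    rw [shuffleTree_eq, zero_smul, add_zero]
    refine add_mem ?_ ?_
    · cases hr : T.root with
      | x =>
        obtain ⟨S, hS, hS'⟩ := hT.exists_child hr
        rw [hS, shuffleForest_singleton]
        have hlt : S.size < T.size := RTree.size_lt_of_mem (by simp [hS])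
        refine graft_mem_treeSpan_of_tree (fun U hU => ⟨?_, Or.inl rfl⟩)
          (ih _ (Nat.add_lt_add_right hlt _) hS' hT' rfl)
        exact .node _ _ (by simp) (by simpa using hU.1)
      | y =>
        refine graft_mem_treeSpan (p := SemiconvergentTree)
          (fun F hF => ⟨.node _ _ (fun _ => rfl) hF, Or.inl rfl⟩)
          (shuffleForest_mem_forestSpan hcT (by simpa using hT') fun s hs t ht => ?_)
        obtain rfl := Multiset.mem_singleton.1 ht
        exact treeSpan_mono (fun _ h => h.1) (ih _ (Nat.add_lt_add_right
          (RTree.size_lt_of_mem hs) _) (hcT s hs) hT' rfl)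
    · cases hr : T'.root with
      | x =>
        obtain ⟨S, hS, hS'⟩ := hT'.exists_child hr
        rw [hS, shuffleForest_singleton]
        have hlt : S.size < T'.size := RTree.size_lt_of_mem (by simp [hS])
        refine graft_mem_treeSpan_of_tree (fun U hU => ⟨?_, Or.inr rfl⟩)
          (ih _ (Nat.add_lt_add_left hlt _) hT hS' rfl)
        exact .node _ _ (by simp) (by simpa using hU.1)
      | y =>
        refine graft_mem_treeSpan (p := SemiconvergentTree)
          (fun F hF => ⟨.node _ _ (fun _ => rfl) hF, Or.inr rfl⟩)
          (shuffleForest_mem_forestSpan (by simpa using hT) hcT' fun s hs t ht => ?_)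
        obtain rfl := Multiset.mem_singleton.1 hs
        exact treeSpan_mono (fun _ h => h.1) (ih _ (Nat.add_lt_add_left
          (RTree.size_lt_of_mem ht) _) hT (hcT' t ht) rfl)

theorem convXY_eq_forestSpan :
    convXY = forestSpan fun T => SemiconvergentTree T ∧ T.root = Letter.x := by
  rw [convXY, forestSpan]
  congr 2
  ext F
  exact forall₂_and.symm

theorem convXY_le_semiXY : convXY ≤ semiXY :=
  Submodule.span_mono (Set.image_mono fun _ h => h.1)

theorem shuffle_mem_convXY {u v : ForestAlg Letter} (hu : u ∈ convXY) (hv : v ∈ convXY) :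
    shuffle u v ∈ convXY := by
  rw [convXY_eq_forestSpan] at *
  refine shuffleWith_mem_forestSpan (fun T hT t ht => ?_) hu hv
  refine treeSpan_mono (fun S hS => ⟨hS.1, ?_⟩) (shuffleTree_zero_mem_treeSpan hT.1 ht.1)
  rcases hS.2 with h | h
  exacts [h.trans hT.2, h.trans ht.2]

end Span

/-- This is y^k / k! ≤ exp y at y = (1 + log x) / 2, where exp y = exp(1/2) x^(1/2). It serves the
sums with x = n and the integrals with x = 1 / (1 - s). -/
theorem exists_one_add_log_pow_le (k : ℕ) :
    ∃ C : ℝ, 0 ≤ C ∧ ∀ x : ℝ, 1 ≤ x → (1 + Real.log x) ^ k ≤ C * x ^ (1 / 2 : ℝ) := by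
  refine ⟨2 ^ k * k.factorial * Real.exp (1 / 2), by positivity, fun x hx => ?_⟩
  have hlog := Real.log_nonneg hx
  have h := Real.pow_div_factorial_le_exp (x := (1 + Real.log x) / 2) (by positivity) k
  have hexp : Real.exp ((1 + Real.log x) / 2) = Real.exp (1 / 2) * x ^ (1 / 2 : ℝ) := by
    rw [Real.rpow_def_of_pos (by linarith), ← Real.exp_add]
    ring_nf
  rw [hexp, div_pow, div_div, div_le_iff₀ (by positivity)] at h
  linarith

/-! ### Limits of forests -/

section Limits

variable {Ω ι : Type*}

/-- If the values of a linear family of functionals converge on the forests that satisfy `p`, then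
they converge on their span, to the linear extension of the limits. -/
theorem tendsto_linExt_limUnder {l : Filter ι} [l.NeBot] (Φ : ForestAlg Ω →ₗ[ℝ] (ι → ℝ))
    {C : Set (Forest Ω)} (h : ∀ F ∈ C, ∃ c, Tendsto (Φ (ofForest F)) l (𝓝 c)) {u : ForestAlg Ω}
    (hu : u ∈ Submodule.span ℝ (ofForest '' C)) :
    Tendsto (Φ u) l (𝓝 (linExt (fun F => limUnder l (Φ (ofForest F))) u)) := by
  induction hu using Submodule.span_induction with
  | mem u hu =>
    obtain ⟨F, hF, rfl⟩ := hu
    rw [linExt_ofForest]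
    exact tendsto_nhds_limUnder (h F hF)
  | zero =>
    rw [map_zero, map_zero]
    exact tendsto_const_nhds
  | add u v _ _ hu hv =>
    rw [map_add, map_add]
    exact hu.add hv
  | smul c u _ hu =>
    rw [map_smul, map_smul]
    exact hu.const_smul c

/-- A multiplicative family of functionals that converges on the trees of a forest converges on
the forest. -/
theorem exists_tendsto_forest {l : Filter ι} (Φ : ForestAlg Ω →ₐ[ℝ] (ι → ℝ)) {F : Forest Ω}
    (h : ∀ T ∈ F, ∃ c, Tendsto (Φ (ofForest {T})) l (𝓝 c)) :
    ∃ c, Tendsto (Φ (ofForest F)) l (𝓝 c) := by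
  induction F using Multiset.induction_on with
  | empty =>
    refine ⟨1, ?_⟩
    rw [ofForest_zero, map_one]
    exact tendsto_const_nhds
  | cons T F ih =>
    obtain ⟨c, hc⟩ := h T (Multiset.mem_cons_self T F)
    obtain ⟨d, hd⟩ := ih fun S hS => h S (Multiset.mem_cons_of_mem hS)
    rw [ofForest_cons, map_mul]
    exact ⟨c * d, hc.mul hd⟩

/-- The values of a forest are bounded by the power of `b` given by its number of vertices, if
this holds for its trees. -/
theorem forest_nonneg_le_pow (Φ : ForestAlg Ω →ₐ[ℝ] ℝ) {b : ℝ} (hb : 0 ≤ b) {F : Forest Ω}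
    (h : ∀ T ∈ F, 0 ≤ Φ (ofForest {T}) ∧ Φ (ofForest {T}) ≤ b ^ T.size) :
    0 ≤ Φ (ofForest F) ∧ Φ (ofForest F) ≤ b ^ (F.map RTree.size).sum := by
  induction F using Multiset.induction_on with
  | empty =>
    rw [ofForest_zero, map_one]
    simp
  | cons T F ih =>
    obtain ⟨h1, h2⟩ := h T (Multiset.mem_cons_self T F)
    obtain ⟨h3, h4⟩ := ih fun S hS => h S (Multiset.mem_cons_of_mem hS)
    rw [ofForest_cons, map_mul, Multiset.map_cons, Multiset.sum_cons, pow_add]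
    exact ⟨mul_nonneg h1 h3, mul_le_mul h2 h4 h3 (pow_nonneg hb _)⟩

end Limits

/-! ### Sums over positive integers -/

section Sums

/-- The summation operator over a family of finite sets. -/
noncomputable def sumOver (s : ℕ+ → Finset ℕ+) : (ℕ+ → ℝ) →ₗ[ℝ] (ℕ+ → ℝ) where
  toFun σ N := ∑ n ∈ s N, σ n
  map_add' _ _ := funext fun _ => Finset.sum_add_distrib
  map_smul' c _ := funext fun _ => (Finset.smul_sum (r := c)).symm

theorem sumOver_apply (s : ℕ+ → Finset ℕ+) (σ : ℕ+ → ℝ) (N : ℕ+) :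
    sumOver s σ N = ∑ n ∈ s N, σ n := rfl

theorem Icc_one_add_one (N : ℕ+) : Finset.Icc 1 (N + 1) = insert (N + 1) (Finset.Icc 1 N) := by
  ext n
  simp only [Finset.mem_Icc, Finset.mem_insert, one_le, true_and]
  rw [le_iff_eq_or_lt, PNat.lt_add_one_iff]

theorem Ico_one_add_one (N : ℕ+) : Finset.Ico 1 (N + 1) = insert N (Finset.Ico 1 N) := by
  ext n
  simp only [Finset.mem_Ico, Finset.mem_insert, one_le, true_and]
  rw [PNat.lt_add_one_iff, le_iff_eq_or_lt]

theorem sum_Icc_add_one (σ : ℕ+ → ℝ) (N : ℕ+) :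
    ∑ n ∈ Finset.Icc 1 (N + 1), σ n = σ (N + 1) + ∑ n ∈ Finset.Icc 1 N, σ n := by
  rw [Icc_one_add_one, Finset.sum_insert]
  simp

theorem sum_Ico_add_one (σ : ℕ+ → ℝ) (N : ℕ+) :
    ∑ n ∈ Finset.Ico 1 (N + 1), σ n = σ N + ∑ n ∈ Finset.Ico 1 N, σ n := by
  rw [Ico_one_add_one, Finset.sum_insert]
  simp

/-- The pairs (m, n) below N split into n < m, m < n and the diagonal, which gives weight 1. The
induction on N compares increments. -/
theorem sumOver_Ico_mul (f g : ℕ+ → ℝ) :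
    sumOver (Finset.Ico 1) f * sumOver (Finset.Ico 1) g =
      sumOver (Finset.Ico 1) (f * sumOver (Finset.Ico 1) g) +
      sumOver (Finset.Ico 1) (sumOver (Finset.Ico 1) f * g) +
      (1 : ℝ) • sumOver (Finset.Ico 1) (f * g) := by
  funext N
  simp only [Pi.mul_apply, Pi.add_apply, sumOver_apply, one_smul]
  induction N using PNat.recOn with
  | one => simp
  | succ N ih =>
    simp only [sum_Ico_add_one]
    linear_combination ih

/-- The regions n ≤ m and m ≤ n both contain the diagonal; removing the double count gives weight
-1. -/
theorem sumOver_Icc_mul (f g : ℕ+ → ℝ) :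
    sumOver (Finset.Icc 1) f * sumOver (Finset.Icc 1) g =
      sumOver (Finset.Icc 1) (f * sumOver (Finset.Icc 1) g) +
      sumOver (Finset.Icc 1) (sumOver (Finset.Icc 1) f * g) +
      (-1 : ℝ) • sumOver (Finset.Icc 1) (f * g) := by
  funext N
  simp only [Pi.mul_apply, Pi.add_apply, Pi.smul_apply, sumOver_apply, smul_eq_mul]
  induction N using PNat.recOn with
  | one => simp
  | succ N ih =>
    simp only [sum_Icc_add_one]
    linear_combination ih

/-- The increment 1 / (N + 1) is at most log((N + 1) / N), by log x ≤ x - 1 at x = N / (N + 1). -/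
theorem sum_Icc_inv_le (N : ℕ+) :
    ∑ n ∈ Finset.Icc 1 N, ((n : ℕ) : ℝ)⁻¹ ≤ 1 + Real.log N := by
  induction N using PNat.recOn with
  | one => simp
  | succ N ih =>
    rw [sum_Icc_add_one]
    have hN : (0 : ℝ) < (N : ℕ) := by exact_mod_cast N.pos
    have h := Real.log_le_sub_one_of_pos (x := (N : ℝ) / (N + 1)) (by positivity)
    rw [Real.log_div (by positivity) (by positivity)] at h
    have h2 : (N : ℝ) / (N + 1) - 1 = -((N : ℝ) + 1)⁻¹ := by
      field_simp
      ring
    rw [h2] at h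
    push_cast at *
    linarith

theorem one_le_one_add_log (n : ℕ+) : (1 : ℝ) ≤ 1 + Real.log n := by
  have : (0 : ℝ) ≤ Real.log n := Real.log_natCast_nonneg n
  linarith

/-- The truncated arborified zeta values for sums over the family `s`. -/
noncomputable def truncZeta (s : ℕ+ → Finset ℕ+) : ForestAlg ℕ+ →ₐ[ℝ] (ℕ+ → ℝ) :=
  operatedHom fun α u => sumOver s (powerSeq α * u)

theorem truncStrict_eq : truncStrict = truncZeta (Finset.Ico 1) :=
  branched_comp_lifted strictSum powerSeq

theorem truncLarge_eq : truncLarge = truncZeta (Finset.Icc 1) :=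
  branched_comp_lifted largeSum powerSeq

theorem powerSeq_add (α β : ℕ+) : powerSeq (α + β) = powerSeq α * powerSeq β := by
  funext n
  simp [powerSeq, pow_add, mul_comm]

theorem powerSeq_nonneg (α n : ℕ+) : 0 ≤ powerSeq α n := by
  simp only [powerSeq]
  positivity

theorem powerSeq_anti {α β : ℕ+} (h : α ≤ β) (n : ℕ+) : powerSeq β n ≤ powerSeq α n := by
  have : (1 : ℝ) ≤ (n : ℕ) := by exact_mod_cast n.pos
  exact inv_anti₀ (by positivity) (pow_le_pow_right₀ this h)

theorem truncZeta_node (s : ℕ+ → Finset ℕ+) (α : ℕ+) (F : Forest ℕ+) (N : ℕ+) :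
    truncZeta s (ofForest {RTree.node α F}) N =
      ∑ n ∈ s N, powerSeq α n * truncZeta s (ofForest F) n := by
  rw [truncZeta, operatedHom_node]
  rfl

/-- Each vertex costs one harmonic sum, hence one factor 1 + log N: the weight is at most 1 / n, and
the bound for the children, increasing in n, is replaced by its value at N. -/
theorem truncZeta_tree_bounds {s : ℕ+ → Finset ℕ+} (hs : ∀ N, s N ⊆ Finset.Icc 1 N)
    (T : RTree ℕ+) (N : ℕ+) : 0 ≤ truncZeta s (ofForest {T}) N ∧
      truncZeta s (ofForest {T}) N ≤ (1 + Real.log N) ^ T.size := by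
  induction T using RTree.induction generalizing N with
  | h α F ih =>
    have hF : ∀ n : ℕ+, 0 ≤ truncZeta s (ofForest F) n ∧
        truncZeta s (ofForest F) n ≤ (1 + Real.log n) ^ (F.map RTree.size).sum := fun n =>
      forest_nonneg_le_pow ((Pi.evalAlgHom ℝ (fun _ : ℕ+ => ℝ) n).comp (truncZeta s))
        (zero_le_one.trans (one_le_one_add_log n)) fun T hT => ih T hT n
    rw [truncZeta_node]
    refine ⟨Finset.sum_nonneg fun n _ => mul_nonneg (powerSeq_nonneg α n) (hF n).1, ?_⟩
    rw [RTree.size_eq, RTree.children_node, pow_add, pow_one]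
    have h0 := one_le_one_add_log N
    calc ∑ n ∈ s N, powerSeq α n * truncZeta s (ofForest F) n
        ≤ ∑ n ∈ Finset.Icc 1 N, powerSeq α n * truncZeta s (ofForest F) n :=
          Finset.sum_le_sum_of_subset_of_nonneg (hs N) fun n _ _ =>
            mul_nonneg (powerSeq_nonneg α n) (hF n).1
      _ ≤ ∑ n ∈ Finset.Icc 1 N,
            ((n : ℕ) : ℝ)⁻¹ * (1 + Real.log N) ^ (F.map RTree.size).sum := by
          refine Finset.sum_le_sum fun n hn => mul_le_mul ?_ ?_ (hF n).1 (by positivity)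
          · simpa [powerSeq] using powerSeq_anti one_le n
          · refine (hF n).2.trans (pow_le_pow_left₀ (by linarith [one_le_one_add_log n]) ?_ _)
            have hn0 : (0 : ℝ) < (n : ℕ) := by exact_mod_cast n.pos
            have hnN : ((n : ℕ) : ℝ) ≤ (N : ℕ) := by exact_mod_cast (Finset.mem_Icc.1 hn).2
            linarith [Real.log_le_log hn0 hnN]
      _ ≤ (1 + Real.log N) * (1 + Real.log N) ^ (F.map RTree.size).sum := by
          rw [← Finset.sum_mul]
          exact mul_le_mul_of_nonneg_right (sum_Icc_inv_le N) (by positivity)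

theorem truncZeta_forest_bounds {s : ℕ+ → Finset ℕ+} (hs : ∀ N, s N ⊆ Finset.Icc 1 N)
    (F : Forest ℕ+) (N : ℕ+) : 0 ≤ truncZeta s (ofForest F) N ∧
      truncZeta s (ofForest F) N ≤ (1 + Real.log N) ^ (F.map RTree.size).sum :=
  forest_nonneg_le_pow ((Pi.evalAlgHom ℝ (fun _ : ℕ+ => ℝ) N).comp (truncZeta s))
    (zero_le_one.trans (one_le_one_add_log N)) fun T _ => truncZeta_tree_bounds hs T N

/-- The summands are nonnegative, so the truncations increase. With root at least 2 they are
O(n^(-2) n^(1/2)), hence summable. -/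
theorem exists_tendsto_truncZeta_tree {s : ℕ+ → Finset ℕ+} (hs : ∀ N, s N ⊆ Finset.Icc 1 N)
    (hmono : Monotone s) {T : RTree ℕ+} (hT : 2 ≤ T.root) :
    ∃ c, Tendsto (truncZeta s (ofForest {T})) atTop (𝓝 c) := by
  rw [← RTree.node_root_children T]
  generalize T.children = F
  have hF := truncZeta_forest_bounds hs F
  have h0 : ∀ n, 0 ≤ powerSeq T.root n * truncZeta s (ofForest F) n := fun n =>
    mul_nonneg (powerSeq_nonneg _ n) (hF n).1
  obtain ⟨C, hC0, hC⟩ := exists_one_add_log_pow_le (F.map RTree.size).sum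
  have hle : ∀ n : ℕ+, powerSeq T.root n * truncZeta s (ofForest F) n ≤
      C * ((n : ℕ) : ℝ) ^ (-(3 / 2) : ℝ) := by
    intro n
    have hn1 : (1 : ℝ) ≤ (n : ℕ) := by exact_mod_cast n.pos
    have hn0 : (0 : ℝ) < (n : ℕ) := by linarith
    have e : ((n : ℕ) : ℝ) ^ (-(3 / 2) : ℝ) = powerSeq 2 n * ((n : ℕ) : ℝ) ^ (1 / 2 : ℝ) := by
      have : powerSeq 2 n = ((n : ℕ) : ℝ) ^ (-2 : ℝ) := by
        rw [Real.rpow_neg hn0.le, Real.rpow_two]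
        rfl
      rw [this, ← Real.rpow_add hn0]
      norm_num
    rw [e, mul_left_comm]
    exact mul_le_mul (powerSeq_anti hT n) ((hF n).2.trans (hC _ hn1)) (hF n).1
      (powerSeq_nonneg 2 n)
  have hsum : Summable fun n : ℕ+ => C * ((n : ℕ) : ℝ) ^ (-(3 / 2) : ℝ) :=
    ((Real.summable_nat_rpow.2 (by norm_num)).comp_injective PNat.coe_injective).mul_left C
  refine ⟨_, tendsto_atTop_ciSup (fun N M h => ?_) ⟨∑' n : ℕ+, C * ((n : ℕ) : ℝ) ^
    (-(3 / 2) : ℝ), ?_⟩⟩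
  · rw [truncZeta_node, truncZeta_node]
    exact Finset.sum_le_sum_of_subset_of_nonneg (hmono h) fun n _ _ => h0 n
  · rintro _ ⟨N, rfl⟩
    rw [truncZeta_node]
    exact (Finset.sum_le_sum fun n _ => hle n).trans
      (hsum.sum_le_tsum _ fun n _ => (h0 n).trans (hle n))

theorem tendsto_truncZeta {s : ℕ+ → Finset ℕ+} (hs : ∀ N, s N ⊆ Finset.Icc 1 N)
    (hmono : Monotone s) {u : ForestAlg ℕ+} (hu : u ∈ convN) :
    Tendsto (truncZeta s u) atTop
      (𝓝 (linExt (fun F => limUnder atTop (truncZeta s (ofForest F))) u)) :=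
  tendsto_linExt_limUnder (truncZeta s).toLinearMap (fun F (hF : ConvergentN F) =>
    exists_tendsto_forest _ fun T hT =>
    exists_tendsto_truncZeta_tree hs hmono (hF T hT)) hu

theorem truncZeta_associator {lam : ℝ} {s : ℕ+ → Finset ℕ+}
    (h : ∀ f g, sumOver s f * sumOver s g = sumOver s (f * sumOver s g) +
      sumOver s (sumOver s f * g) + lam • sumOver s (f * g)) (u v w : ForestAlg ℕ+) :
    truncZeta s (associator (lambdaShuffle lam) u v w) = 0 :=
  map_associator_eq_zero (map_shuffleWith (operatedHom_shuffleForest lam (· + ·) (sumOver s)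
    powerSeq h fun a b => by rw [powerSeq_add])) u v w

theorem tendsto_truncStrict (u : convN) :
    Tendsto (truncStrict (u : ForestAlg ℕ+)) atTop (𝓝 (zetaStuffle u)) := by
  rw [zetaStuffle, truncStrict_eq]
  exact tendsto_truncZeta (fun _ => Finset.Ico_subset_Icc_self)
    (fun _ _ h => Finset.Ico_subset_Ico_right h) u.2

theorem tendsto_truncLarge (u : convN) :
    Tendsto (truncLarge (u : ForestAlg ℕ+)) atTop (𝓝 (zetaStuffleStar u)) := by
  rw [zetaStuffleStar, truncLarge_eq]
  exact tendsto_truncZeta (fun _ => subset_rfl)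
    (fun _ _ h => Finset.Icc_subset_Icc_right h) u.2

theorem mem_kernel {Ω : Type*} {C : Submodule ℝ (ForestAlg Ω)} {z : C →ₗ[ℝ] ℝ}
    {u : ForestAlg Ω} (hu : u ∈ C) (h : z ⟨u, hu⟩ = 0) : u ∈ kernel z :=
  ⟨⟨u, hu⟩, h, rfl⟩

theorem associator_mem_kernel_zetaStuffle {u v w : ForestAlg ℕ+} (hu : u ∈ convN)
    (hv : v ∈ convN) (hw : w ∈ convN) :
    associator (lambdaShuffle 1) u v w ∈ kernel zetaStuffle := by
  refine mem_kernel (associator_mem (fun _ h _ h' => lambdaShuffle_mem_convN 1 h h') hu hv hw)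
    (tendsto_nhds_unique (tendsto_truncStrict _) ?_)
  rw [truncStrict_eq, truncZeta_associator sumOver_Ico_mul]
  exact tendsto_const_nhds

theorem associator_mem_kernel_zetaStuffleStar {u v w : ForestAlg ℕ+} (hu : u ∈ convN)
    (hv : v ∈ convN) (hw : w ∈ convN) :
    associator (lambdaShuffle (-1)) u v w ∈ kernel zetaStuffleStar := by
  refine mem_kernel (associator_mem (fun _ h _ h' => lambdaShuffle_mem_convN (-1) h h') hu hv hw)
    (tendsto_nhds_unique (tendsto_truncLarge _) ?_)
  rw [truncLarge_eq, truncZeta_associator sumOver_Icc_mul]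
  exact tendsto_const_nhds

end Sums

/-! ### Chen integrals as morphisms into continuous functions. -/

section Chen

open MeasureTheory intervalIntegral

theorem algHom_ext_of_trees {Ω A : Type*} [CommRing A] [Algebra ℝ A]
    {Φ Ψ : ForestAlg Ω →ₐ[ℝ] A} {F : Forest Ω}
    (h : ∀ T ∈ F, Φ (ofForest {T}) = Ψ (ofForest {T})) : Φ (ofForest F) = Ψ (ofForest F) := by
  induction F using Multiset.induction_on with
  | empty => rw [ofForest_zero, map_one, map_one]
  | cons T F ih =>
    rw [ofForest_cons, map_mul, map_mul, h T (Multiset.mem_cons_self T F),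
      ih fun S hS => h S (Multiset.mem_cons_of_mem hS)]

/-- The arborified Chen integrals with base point `ε`, evaluated at `t`. -/
noncomputable def chenAt (ε t : ℝ) : ForestAlg Letter →ₐ[ℝ] ℝ :=
  (Pi.evalAlgHom ℝ (fun _ : ℝ => ℝ) t).comp (chenIntegral ε)

theorem chenIntegral_apply (ε : ℝ) (u : ForestAlg Letter) (t : ℝ) :
    chenIntegral ε u t = chenAt ε t u := rfl

theorem chenAt_node (ε t : ℝ) (a : Letter) (F : Forest Letter) :
    chenAt ε t (ofForest {RTree.node a F}) =
      ∫ s in ε..t, letterFun a s * chenAt ε s (ofForest F) := by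
  rw [← chenIntegral_apply, chenIntegral, branched_comp_lifted, operatedHom_node,
    ← branched_comp_lifted]
  rfl

/-- The primitive that vanishes at `ε`, as an operator on continuous functions. -/
noncomputable def primitive (ε : ℝ) : C(ℝ, ℝ) →ₗ[ℝ] C(ℝ, ℝ) where
  toFun f := ⟨fun x => ∫ t in ε..x, f t,
    continuous_primitive (fun a b => f.continuous.intervalIntegrable a b) ε⟩
  map_add' f g := ContinuousMap.ext fun x =>
    integral_add (f.continuous.intervalIntegrable ε x) (g.continuous.intervalIntegrable ε x)
  map_smul' c f := ContinuousMap.ext fun _ => integral_smul c f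

theorem primitive_apply (ε : ℝ) (f : C(ℝ, ℝ)) (x : ℝ) : primitive ε f x = ∫ t in ε..x, f t := rfl

/-- Integration by parts; the boundary term at `ε` vanishes because both primitives do. -/
theorem primitive_mul (ε : ℝ) (f g : C(ℝ, ℝ)) : primitive ε f * primitive ε g =
    primitive ε (f * primitive ε g) + primitive ε (primitive ε f * g) +
      (0 : ℝ) • primitive ε (f * g) := by
  have hd : ∀ (h : C(ℝ, ℝ)) x, HasDerivAt (primitive ε h) (h x) x := fun h x =>
    integral_hasDerivAt_right (h.continuous.intervalIntegrable ε x)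
      h.continuous.aestronglyMeasurable.stronglyMeasurableAtFilter h.continuous.continuousAt
  rw [zero_smul, add_zero, ← map_add]
  ext x
  have := integral_deriv_mul_eq_sub (a := ε) (b := x) (fun y _ => hd f y) (fun y _ => hd g y)
    (f.continuous.intervalIntegrable ε x) (g.continuous.intervalIntegrable ε x)
  rw [primitive_apply, ContinuousMap.mul_apply]
  have h0 : primitive ε f ε = 0 := integral_same
  rw [h0, zero_mul, sub_zero] at this
  exact this.symm

/-- Clamping the argument to `[c, b]` removes the poles. This moves the computation to `C(ℝ, ℝ)`,
where integration is linear; on arbitrary functions additivity can fail, since the integral of a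
non-integrable function is 0 by convention. -/
theorem exists_continuous_letterFun {c b : ℝ} (hc : 0 < c) (hb : b < 1) (hcb : c ≤ b) :
    ∃ e : Letter → C(ℝ, ℝ), ∀ a, ∀ t ∈ Set.Icc c b, e a t = letterFun a t := by
  have key : ∀ a, Continuous fun t => letterFun a (max c (min b t)) := by
    rintro (_ | _)
    · refine continuous_const.div (by fun_prop) fun t => ?_
      have := le_max_left c (min b t)
      linarith
    · refine continuous_const.div (by fun_prop) fun t => ?_
      have := max_le hcb (min_le_left b t)
      linarith
  refine ⟨fun a => ⟨_, key a⟩, fun a t ht => ?_⟩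
  show letterFun a (max c (min b t)) = letterFun a t
  rw [min_eq_right ht.2, max_eq_right ht.1]

/-- The iterated integrals from `ε` to `t` only use values on `[ε, t]`, where `e` and `letterFun`
agree. -/
theorem chenAt_eq_primitive {ε b : ℝ} {e : Letter → C(ℝ, ℝ)}
    (he : ∀ a, ∀ t ∈ Set.Icc ε b, e a t = letterFun a t) (u : ForestAlg Letter) {t : ℝ}
    (ht : t ∈ Set.Icc ε b) :
    chenAt ε t u = operatedHom (fun a w => primitive ε (e a * w)) u t := by
  let Ψ : ℝ → ForestAlg Letter →ₐ[ℝ] ℝ := fun t =>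
    (ContinuousMap.evalAlgHom ℝ ℝ t).comp (operatedHom fun a w => primitive ε (e a * w))
  have key : ∀ (T : RTree Letter), ∀ t ∈ Set.Icc ε b,
      chenAt ε t (ofForest {T}) = Ψ t (ofForest {T}) := by
    intro T
    induction T using RTree.induction with
    | h a F ih =>
      intro t ht
      have : Ψ t (ofForest {RTree.node a F}) = ∫ s in ε..t, e a s * Ψ s (ofForest F) := by
        show operatedHom (fun a w => primitive ε (e a * w)) (ofForest {RTree.node a F}) t = _
        rw [operatedHom_node]
        rfl
      rw [chenAt_node, this]
      refine integral_congr fun s hs => ?_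
      rw [Set.uIcc_of_le ht.1] at hs
      have hs' : s ∈ Set.Icc ε b := ⟨hs.1, hs.2.trans ht.2⟩
      rw [he a s hs', algHom_ext_of_trees fun T hT => ih T hT s hs']
  have : chenAt ε t = Ψ t :=
    algHom_ext_ofForest fun F => algHom_ext_of_trees fun T _ => key T t ht
  rw [this]
  rfl

theorem continuousOn_chenAt {ε b : ℝ} (hε : 0 < ε) (hb : b < 1) (u : ForestAlg Letter) :
    ContinuousOn (fun t => chenAt ε t u) (Set.Icc ε b) := by
  rcases le_or_gt ε b with h | h
  · obtain ⟨e, he⟩ := exists_continuous_letterFun hε hb h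
    exact ((operatedHom (fun a w => primitive ε (e a * w)) u).continuous.continuousOn).congr
      fun t ht => chenAt_eq_primitive he u ht
  · rw [Set.Icc_eq_empty h.not_ge]
    exact continuousOn_empty _

theorem chenAt_associator {ε t : ℝ} (hε : 0 < ε) (ht : t < 1) (hεt : ε ≤ t)
    (u v w : ForestAlg Letter) : chenAt ε t (associator shuffle u v w) = 0 := by
  obtain ⟨e, he⟩ := exists_continuous_letterFun hε ht hεt
  rw [chenAt_eq_primitive he _ (Set.right_mem_Icc.2 hεt), shuffle,
    map_associator_eq_zero (map_shuffleWith (operatedHom_shuffleForest 0 _ (primitive ε) e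
      (primitive_mul ε) fun a b => by rw [zero_smul, zero_smul]))]
  rfl

theorem intervalIntegrable_chenAt {ε c t : ℝ} (hε : 0 < ε) (ht : t < 1) (hεc : ε ≤ c)
    (hct : c ≤ t) (a : Letter) (F : Forest Letter) :
    IntervalIntegrable (fun s => letterFun a s * chenAt ε s (ofForest F)) volume c t := by
  obtain ⟨e, he⟩ := exists_continuous_letterFun hε ht (hεc.trans hct)
  refine ContinuousOn.intervalIntegrable_of_Icc hct ?_
  refine (((e a).continuous.continuousOn).mul (continuousOn_chenAt hε ht (ofForest F))).congr
    (fun s hs => ?_) |>.mono (Set.Icc_subset_Icc_left hεc)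
  rw [Pi.mul_apply, he a s hs]

/-! ### Positivity and monotonicity of the Chen integrals. -/

theorem letterFun_nonneg (a : Letter) {t : ℝ} (h0 : 0 < t) (h1 : t < 1) : 0 ≤ letterFun a t := by
  cases a
  · exact one_div_nonneg.2 h0.le
  · exact one_div_nonneg.2 (by linarith)

theorem chenAt_nonneg_of_trees {ε t : ℝ} {F : Forest Letter}
    (h : ∀ T ∈ F, 0 ≤ chenAt ε t (ofForest {T})) : 0 ≤ chenAt ε t (ofForest F) := by
  induction F using Multiset.induction_on with
  | empty =>
    rw [ofForest_zero, map_one]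
    exact zero_le_one
  | cons T F ih =>
    rw [ofForest_cons, map_mul]
    exact mul_nonneg (h T (Multiset.mem_cons_self T F))
      (ih fun S hS => h S (Multiset.mem_cons_of_mem hS))

theorem chenAt_tree_nonneg {ε t : ℝ} (hε : 0 < ε) (hεt : ε ≤ t) (ht : t < 1)
    (T : RTree Letter) : 0 ≤ chenAt ε t (ofForest {T}) := by
  induction T using RTree.induction generalizing t with
  | h a F ih =>
    rw [chenAt_node]
    exact integral_nonneg hεt fun s hs => mul_nonneg
      (letterFun_nonneg a (hε.trans_le hs.1) (hs.2.trans_lt ht))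
      (chenAt_nonneg_of_trees fun T hT => ih T hT hs.1 (hs.2.trans_lt ht))

theorem chenAt_nonneg {ε t : ℝ} (hε : 0 < ε) (hεt : ε ≤ t) (ht : t < 1) (F : Forest Letter) :
    0 ≤ chenAt ε t (ofForest F) :=
  chenAt_nonneg_of_trees fun T _ => chenAt_tree_nonneg hε hεt ht T

theorem letterFun_mul_chenAt_nonneg {ε t : ℝ} (hε : 0 < ε) (hεt : ε ≤ t) (ht : t < 1)
    (a : Letter) (F : Forest Letter) : 0 ≤ letterFun a t * chenAt ε t (ofForest F) :=
  mul_nonneg (letterFun_nonneg a (hε.trans_le hεt) ht) (chenAt_nonneg hε hεt ht F)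

theorem chenAt_tree_mono {ε t t' : ℝ} (hε : 0 < ε) (hεt : ε ≤ t) (htt : t ≤ t') (ht : t' < 1)
    (T : RTree Letter) : chenAt ε t (ofForest {T}) ≤ chenAt ε t' (ofForest {T}) := by
  rw [← RTree.node_root_children T, chenAt_node, chenAt_node,
    ← integral_add_adjacent_intervals (intervalIntegrable_chenAt hε (htt.trans_lt ht) le_rfl hεt
      T.root T.children) (intervalIntegrable_chenAt hε ht hεt htt T.root T.children)]
  exact le_add_of_nonneg_right (integral_nonneg htt fun s hs =>
    letterFun_mul_chenAt_nonneg hε (hεt.trans hs.1) (hs.2.trans_lt ht) _ _)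

theorem chenAt_anti_of_trees {ε ε' t : ℝ} {F : Forest Letter} (hε : 0 < ε) (hεt : ε ≤ t)
    (hεε : ε' ≤ ε) (hε' : 0 < ε') (ht : t < 1)
    (h : ∀ T ∈ F, chenAt ε t (ofForest {T}) ≤ chenAt ε' t (ofForest {T})) :
    chenAt ε t (ofForest F) ≤ chenAt ε' t (ofForest F) := by
  induction F using Multiset.induction_on with
  | empty => rw [ofForest_zero, map_one, map_one]
  | cons T F ih =>
    rw [ofForest_cons, map_mul, map_mul]
    exact mul_le_mul (h T (Multiset.mem_cons_self T F))
      (ih fun S hS => h S (Multiset.mem_cons_of_mem hS)) (chenAt_nonneg hε hεt ht F)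
      (chenAt_nonneg hε' (hεε.trans hεt) ht {T})

/-- Lowering the base point enlarges the domain of a nonnegative integrand and, by induction, the
integrand itself. -/
theorem chenAt_tree_anti {ε ε' t : ℝ} (hε' : 0 < ε') (hεε : ε' ≤ ε) (hεt : ε ≤ t) (ht : t < 1)
    (T : RTree Letter) : chenAt ε t (ofForest {T}) ≤ chenAt ε' t (ofForest {T}) := by
  have hε : 0 < ε := hε'.trans_le hεε
  induction T using RTree.induction generalizing t with
  | h a F ih =>
    rw [chenAt_node, chenAt_node, ← integral_add_adjacent_intervals
      (intervalIntegrable_chenAt hε' (hεt.trans_lt ht) le_rfl hεε a F)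
      (intervalIntegrable_chenAt hε' ht hεε hεt a F)]
    refine le_add_of_nonneg_of_le (integral_nonneg hεε fun s hs =>
      letterFun_mul_chenAt_nonneg hε' hs.1 (hs.2.trans_lt (hεt.trans_lt ht)) _ _) ?_
    refine integral_mono_on hεt (intervalIntegrable_chenAt hε ht le_rfl hεt a F)
      (intervalIntegrable_chenAt hε' ht hεε hεt a F) fun s hs => ?_
    have hs1 : s < 1 := hs.2.trans_lt ht
    exact mul_le_mul_of_nonneg_left (chenAt_anti_of_trees hε hs.1 hεε hε' hs1
      fun T hT => ih T hT hs.1 hs1) (letterFun_nonneg a (hε.trans_le hs.1) hs1)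

/-! ### Bounds uniform in the base point. -/

theorem integral_one_div_one_sub {ε t : ℝ} (hεt : ε ≤ t) (ht : t < 1) :
    ∫ s in ε..t, 1 / (1 - s) = Real.log (1 - ε) - Real.log (1 - t) := by
  have : ∀ s ∈ Set.uIcc ε t, HasDerivAt (fun s => -Real.log (1 - s)) (1 / (1 - s)) s := by
    intro s hs
    rw [Set.uIcc_of_le hεt] at hs
    have h := ((hasDerivAt_id s).const_sub 1).log (by simp only [id]; linarith [hs.2])
    convert! h.neg using 1
    simp only [id]
    ring
  rw [integral_eq_sub_of_hasDerivAt this]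
  · ring
  · refine ContinuousOn.intervalIntegrable_of_Icc hεt
      (continuousOn_const.div (by fun_prop) fun s hs => ?_)
    linarith [hs.2]

theorem log_one_sub_nonpos {t : ℝ} (h0 : 0 ≤ t) (ht : t < 1) : Real.log (1 - t) ≤ 0 :=
  Real.log_nonpos (by linarith) (by linarith)

/-- The factor `t` makes the bound inductive: at a vertex x, the factor s of its only child cancels
the pole 1 / s. At a vertex y these factors are discarded, and integrating 1 / (1 - s) produces a
logarithm that again vanishes to first order at 0. -/
theorem chenAt_tree_le {ε t : ℝ} (hε : 0 < ε) (hεt : ε ≤ t) (ht : t < 1) {T : RTree Letter}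
    (hT : SemiconvergentTree T) :
    chenAt ε t (ofForest {T}) ≤ t * (1 - Real.log (1 - t)) ^ T.size := by
  induction hT generalizing t with
  | node a F hroot hF ih =>
    have ht0 : 0 < t := hε.trans_le hεt
    set L : ℝ := 1 - Real.log (1 - t) with hL
    have hL1 : 1 ≤ L := by linarith [log_one_sub_nonpos ht0.le ht]
    have hmono : ∀ s ∈ Set.Icc ε t, 1 ≤ 1 - Real.log (1 - s) ∧ 1 - Real.log (1 - s) ≤ L := by
      intro s hs
      have h1 := log_one_sub_nonpos (hε.le.trans hs.1) (hs.2.trans_lt ht)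
      have h2 := Real.log_le_log (x := 1 - t) (y := 1 - s) (by linarith) (by linarith [hs.2])
      constructor <;> linarith
    rw [chenAt_node, RTree.size_eq, RTree.children_node]
    set k := (F.map RTree.size).sum with hk
    have hint := intervalIntegrable_chenAt hε ht le_rfl hεt a F
    cases a with
    | x =>
      obtain ⟨S, rfl⟩ := Multiset.card_eq_one.1 (show F.card = 1 by
        have : ¬ (F.card = 0 ∨ 2 ≤ F.card) := fun h => by cases hroot h
        omega)
      have hkS : k = S.size := by simp [hk]
      calc ∫ s in ε..t, letterFun Letter.x s * chenAt ε s (ofForest {S})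
          ≤ ∫ _ in ε..t, L ^ k := by
            refine integral_mono_on hεt hint intervalIntegrable_const fun s hs => ?_
            have hs0 : 0 < s := hε.trans_le hs.1
            have h := ih S (by simp) hs.1 (hs.2.trans_lt ht)
            show 1 / s * _ ≤ _
            rw [one_div, inv_mul_le_iff₀ hs0, hkS]
            exact h.trans (mul_le_mul_of_nonneg_left (pow_le_pow_left₀
              (by linarith [(hmono s hs).1]) (hmono s hs).2 _) hs0.le)
        _ = (t - ε) * L ^ k := by rw [intervalIntegral.integral_const, smul_eq_mul]
        _ ≤ t * L ^ (1 + k) := mul_le_mul (by linarith)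
            (pow_le_pow_right₀ hL1 (by omega)) (by positivity) ht0.le
    | y =>
      -- Multiplying log u ≤ u - 1 at u = 1 / (1 - t) by 1 - t gives -(1 - t) log(1 - t) ≤ t, which
      -- rearranges to the claim.
      have hlog : -Real.log (1 - t) ≤ t * L := by
        have h := Real.log_le_sub_one_of_pos (x := (1 - t)⁻¹) (inv_pos.2 (by linarith))
        rw [Real.log_inv] at h
        have h2 : (1 - t) * ((1 - t)⁻¹ - 1) = t := by
          have : (1 - t) ≠ 0 := by linarith
          field_simp
          ring
        have h3 := mul_le_mul_of_nonneg_left h (show 0 ≤ 1 - t by linarith)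
        rw [h2] at h3
        rw [hL]
        linarith
      calc ∫ s in ε..t, letterFun Letter.y s * chenAt ε s (ofForest F)
          ≤ ∫ s in ε..t, 1 / (1 - s) * L ^ k := by
            refine integral_mono_on hεt hint ?_ fun s hs => ?_
            · refine ContinuousOn.intervalIntegrable_of_Icc hεt
                ((continuousOn_const.div (by fun_prop) fun s hs => ?_).mul continuousOn_const)
              linarith [hs.2]
            · have hs1 : s < 1 := hs.2.trans_lt ht
              have h1 := (hmono s hs).1
              refine mul_le_mul_of_nonneg_left ?_
                (letterFun_nonneg Letter.y (hε.trans_le hs.1) hs1)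
              refine (forest_nonneg_le_pow (chenAt ε s) (zero_le_one.trans h1)
                fun T hT => ⟨chenAt_tree_nonneg hε hs.1 hs1 T, (ih T hT hs.1 hs1).trans
                  (mul_le_of_le_one_left (by positivity) hs1.le)⟩).2.trans
                (pow_le_pow_left₀ (zero_le_one.trans h1) (hmono s hs).2 _)
        _ = (Real.log (1 - ε) - Real.log (1 - t)) * L ^ k := by
            rw [intervalIntegral.integral_mul_const, integral_one_div_one_sub hεt ht]
        _ ≤ t * L * L ^ k := mul_le_mul_of_nonneg_right
            (by linarith [log_one_sub_nonpos hε.le (hεt.trans_lt ht)]) (by positivity)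
        _ = t * L ^ (1 + k) := by ring

theorem integral_inv_sqrt_one_sub_le {ε t : ℝ} (hε : 0 ≤ ε) (hεt : ε ≤ t) (ht : t < 1) :
    ∫ s in ε..t, (√(1 - s))⁻¹ ≤ 2 := by
  have hpos : ∀ s ∈ Set.Icc ε t, 0 < 1 - s := fun s hs => by linarith [hs.2]
  have : ∀ s ∈ Set.uIcc ε t, HasDerivAt (fun s => -2 * √(1 - s)) (√(1 - s))⁻¹ s := by
    intro s hs
    rw [Set.uIcc_of_le hεt] at hs
    have h := (((hasDerivAt_id s).const_sub 1).sqrt (hpos s hs).ne').const_mul (-2)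
    convert! h using 1
    have := Real.sqrt_pos.2 (hpos s hs)
    simp only [id]
    field_simp
  rw [integral_eq_sub_of_hasDerivAt this]
  · have h1 : √(1 - ε) ≤ 1 := Real.sqrt_le_one.2 (by linarith)
    linarith [Real.sqrt_nonneg (1 - t)]
  · exact ContinuousOn.intervalIntegrable_of_Icc hεt (ContinuousOn.inv₀ (by fun_prop)
      fun s hs => (Real.sqrt_pos.2 (hpos s hs)).ne')

/-- The child's factor s cancels the root's 1 / s, and the power of the logarithm is at most C (1 -
s)^(-1/2), whose integral stays below 2C for all `ε` and `t`. -/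
theorem exists_chenAt_convergent_le {T : RTree Letter} (hT : SemiconvergentTree T)
    (hx : T.root = Letter.x) :
    ∃ M, ∀ ε t : ℝ, 0 < ε → ε ≤ t → t < 1 → chenAt ε t (ofForest {T}) ≤ M := by
  obtain ⟨S, hS, hS'⟩ := hT.exists_child hx
  obtain ⟨C, hC0, hC⟩ := exists_one_add_log_pow_le S.size
  refine ⟨C * 2, fun ε t hε hεt ht => ?_⟩
  rw [← RTree.node_root_children T, hx, hS, chenAt_node]
  have hpos : ∀ s ∈ Set.Icc ε t, 0 < 1 - s := fun s hs => by linarith [hs.2]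
  calc ∫ s in ε..t, letterFun Letter.x s * chenAt ε s (ofForest {S})
      ≤ ∫ s in ε..t, C * (√(1 - s))⁻¹ := by
        refine integral_mono_on hεt (intervalIntegrable_chenAt hε ht le_rfl hεt _ _) ?_
          fun s hs => ?_
        · exact ContinuousOn.intervalIntegrable_of_Icc hεt (continuousOn_const.mul
            (ContinuousOn.inv₀ (by fun_prop) fun s hs => (Real.sqrt_pos.2 (hpos s hs)).ne'))
        · have hs0 : 0 < s := hε.trans_le hs.1
          have h := hC (1 - s)⁻¹ ((one_le_inv₀ (hpos s hs)).2 (by linarith))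
          rw [Real.log_inv, ← sub_eq_add_neg, ← Real.sqrt_eq_rpow, Real.sqrt_inv] at h
          show 1 / s * _ ≤ _
          rw [one_div, inv_mul_le_iff₀ hs0]
          exact (chenAt_tree_le hε hs.1 (hs.2.trans_lt ht) hS').trans
            (mul_le_mul_of_nonneg_left h hs0.le)
    _ ≤ C * 2 := by
        rw [intervalIntegral.integral_const_mul]
        exact mul_le_mul_of_nonneg_left (integral_inv_sqrt_one_sub_le hε.le hεt ht) hC0

/-! ### The limits ε → 0⁺ and z → 1⁻. -/

/-- The arborified Chen integrals at `z`, as functions of the base point. -/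
noncomputable def chenBase (z : ℝ) : ForestAlg Letter →ₐ[ℝ] (ℝ → ℝ) :=
  AlgHom.pi fun ε => chenAt ε z

theorem exists_tendsto_chenBase_tree {z : ℝ} (hz : z ∈ Set.Ioo (0 : ℝ) 1) {T : RTree Letter}
    (hT : SemiconvergentTree T) :
    ∃ c, Tendsto (chenBase z (ofForest {T})) (𝓝[>] 0) (𝓝 c) := by
  refine ⟨_, AntitoneOn.tendsto_nhdsWithin_Ioo_right (y := z) (Set.nonempty_Ioo.2 hz.1)
    (fun ε' hε' ε hε h => chenAt_tree_anti hε'.1 h hε.2.le hz.2 T)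
    ⟨z * (1 - Real.log (1 - z)) ^ T.size, ?_⟩⟩
  rintro _ ⟨ε, hε, rfl⟩
  exact chenAt_tree_le hε.1 hε.2.le hz.2 hT

theorem linExt_apply {Ω ι : Type*} (f : Forest Ω → ι → ℝ) (u : ForestAlg Ω) (i : ι) :
    linExt f u i = linExt (fun F => f F i) u := by
  have : LinearMap.proj i ∘ₗ linExt f = linExt fun F => f F i :=
    linearMap_ext_ofForest fun F => by simp [linExt_ofForest]
  exact LinearMap.congr_fun this u

theorem tendsto_polylog {u : ForestAlg Letter} (hu : u ∈ semiXY) {z : ℝ}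
    (hz : z ∈ Set.Ioo (0 : ℝ) 1) :
    Tendsto (fun ε => chenAt ε z u) (𝓝[>] 0) (𝓝 (polylog u z)) := by
  have := tendsto_linExt_limUnder (l := 𝓝[>] (0 : ℝ)) (chenBase z).toLinearMap
    (fun F (hF : SemiconvergentXY F) => exists_tendsto_forest (chenBase z) fun T hT =>
      exists_tendsto_chenBase_tree hz (hF T hT)) hu
  rw [polylog, linExt_apply]
  -- The conventional value of `polylog` at 0 plays no role, as z > 0.
  simp only [if_neg hz.1.ne']
  exact this

theorem eventually_base {z : ℝ} (hz : 0 < z) : ∀ᶠ ε in 𝓝[>] (0 : ℝ), 0 < ε ∧ ε ≤ z := by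
  filter_upwards [Ioc_mem_nhdsGT hz] with ε hε using hε

theorem exists_tendsto_polylog_tree {T : RTree Letter} (hT : SemiconvergentTree T)
    (hx : T.root = Letter.x) :
    ∃ c, Tendsto (polylog (ofForest {T})) (𝓝[<] 1) (𝓝 c) := by
  have hmem : ofForest {T} ∈ semiXY :=
    Submodule.subset_span ⟨{T}, fun S hS => by rwa [Multiset.mem_singleton.1 hS], rfl⟩
  obtain ⟨M, hM⟩ := exists_chenAt_convergent_le hT hx
  refine ⟨_, MonotoneOn.tendsto_nhdsWithin_Ioo_left (x := (1 : ℝ)) (y := 0) (Set.nonempty_Ioo.2 one_pos)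
    (fun z hz z' hz' h => ?_) ⟨M, ?_⟩⟩
  · refine le_of_tendsto_of_tendsto (tendsto_polylog hmem hz) (tendsto_polylog hmem hz') ?_
    filter_upwards [eventually_base hz.1] with ε hε
    exact chenAt_tree_mono hε.1 hε.2 h hz'.2 T
  · rintro _ ⟨z, hz, rfl⟩
    refine le_of_tendsto (tendsto_polylog hmem hz) ?_
    filter_upwards [eventually_base hz.1] with ε hε
    exact hM ε z hε.1 hε.2 hz.2

/-- `polylog` is defined only as a linear extension of limits; its multiplicativity on
semiconvergent forests, for z in (0, 1), is recovered from that of `chenAt` by uniqueness of limits.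
-/
theorem exists_tendsto_polylog {F : Forest Letter} (hF : ConvergentXY F) :
    ∃ c, Tendsto (polylog (ofForest F)) (𝓝[<] 1) (𝓝 c) := by
  have hev : ∀ᶠ z in 𝓝[<] (1 : ℝ), z ∈ Set.Ioo (0 : ℝ) 1 := Ioo_mem_nhdsLT one_pos
  induction F using Multiset.induction_on with
  | empty =>
    refine ⟨1, tendsto_const_nhds.congr' (hev.mono fun z hz => ?_)⟩
    refine tendsto_nhds_unique ?_ (tendsto_polylog (Submodule.subset_span ⟨0, hF.1, rfl⟩) hz)
    simp only [ofForest_zero, map_one]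
    exact tendsto_const_nhds
  | cons T F ih =>
    have hT := hF.1 T (Multiset.mem_cons_self T F)
    have hF' : SemiconvergentXY F := fun S hS => hF.1 S (Multiset.mem_cons_of_mem hS)
    obtain ⟨c, hc⟩ := exists_tendsto_polylog_tree hT (hF.2 T (Multiset.mem_cons_self T F))
    obtain ⟨d, hd⟩ := ih ⟨hF', fun S hS => hF.2 S (Multiset.mem_cons_of_mem hS)⟩
    refine ⟨c * d, (hc.mul hd).congr' (hev.mono fun z hz => ?_)⟩
    have h1 := tendsto_polylog (Submodule.subset_span ⟨{T}, fun S hS => by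
      rwa [Multiset.mem_singleton.1 hS], rfl⟩) hz
    have h2 := tendsto_polylog (Submodule.subset_span ⟨F, hF', rfl⟩) hz
    refine tendsto_nhds_unique (h1.mul h2) ?_
    simp only [← map_mul, ← ofForest_cons]
    exact tendsto_polylog (Submodule.subset_span ⟨T ::ₘ F, hF.1, rfl⟩) hz

theorem tendsto_zetaShuffle (u : convXY) :
    Tendsto (polylog (u : ForestAlg Letter)) (𝓝[<] 1) (𝓝 (zetaShuffle u)) :=
  tendsto_linExt_limUnder polylog (fun F (hF : ConvergentXY F) => exists_tendsto_polylog hF) u.2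

/-- For fixed z in (0, 1) the Chen integral of the associator vanishes whenever 0 < ε ≤ z, so its
polylogarithm is zero on (0, 1), and so is the limit at 1. -/
theorem associator_mem_kernel_zetaShuffle {u v w : ForestAlg Letter} (hu : u ∈ convXY)
    (hv : v ∈ convXY) (hw : w ∈ convXY) : associator shuffle u v w ∈ kernel zetaShuffle := by
  have hmem := associator_mem (fun _ h _ h' => shuffle_mem_convXY h h') hu hv hw
  have hev : ∀ᶠ z in 𝓝[<] (1 : ℝ), z ∈ Set.Ioo (0 : ℝ) 1 := Ioo_mem_nhdsLT one_pos
  refine mem_kernel hmem (tendsto_nhds_unique (tendsto_zetaShuffle _) ?_)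
  refine tendsto_const_nhds.congr' (hev.mono fun z hz => ?_)
  refine tendsto_nhds_unique (tendsto_const_nhds.congr' ?_)
    (tendsto_polylog (convXY_le_semiXY hmem) hz)
  filter_upwards [eventually_base hz.1] with ε hε
  exact (chenAt_associator hε.1 hz.2 hε.2 u v w).symm

end Chen

end AZV

open AZV Filter Topology in
theorem mainTheorem7 :
    -- the limits that define the three arborified zeta maps exist
    ((∀ F : convN, Tendsto (truncStrict (F : ForestAlg ℕ+)) atTop (𝓝 (zetaStuffle F))) ∧
     (∀ F : convN, Tendsto (truncLarge (F : ForestAlg ℕ+)) atTop (𝓝 (zetaStuffleStar F))) ∧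
     (∀ F ∈ semiXY, ∀ z ∈ Set.Ioo (0 : ℝ) 1,
        Tendsto (fun ε => chenIntegral ε F z) (𝓝[>] 0) (𝓝 (polylog F z))) ∧
     (∀ F : convXY,
        Tendsto (polylog (F : ForestAlg Letter)) (𝓝[<] 1) (𝓝 (zetaShuffle F)))) ∧
    -- the associators of convergent forests lie in the kernels
    (∀ F₁ ∈ convN, ∀ F₂ ∈ convN, ∀ F₃ ∈ convN,
      associator (lambdaShuffle 1) F₁ F₂ F₃ ∈ kernel zetaStuffle) ∧
    (∀ F₁ ∈ convN, ∀ F₂ ∈ convN, ∀ F₃ ∈ convN,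
      associator (lambdaShuffle (-1)) F₁ F₂ F₃ ∈ kernel zetaStuffleStar) ∧
    (∀ f₁ ∈ convXY, ∀ f₂ ∈ convXY, ∀ f₃ ∈ convXY,
      associator shuffle f₁ f₂ f₃ ∈ kernel zetaShuffle) :=
  ⟨⟨tendsto_truncStrict, tendsto_truncLarge, fun _ hF _ hz => tendsto_polylog hF hz,
      tendsto_zetaShuffle⟩,
    fun _ h₁ _ h₂ _ h₃ => associator_mem_kernel_zetaStuffle h₁ h₂ h₃,
    fun _ h₁ _ h₂ _ h₃ => associator_mem_kernel_zetaStuffleStar h₁ h₂ h₃,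
    fun _ h₁ _ h₂ _ h₃ => associator_mem_kernel_zetaShuffle h₁ h₂ h₃⟩
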